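/- Let $\mathcal{M}(2,\mathbb{C})$ be the space of complex $2\times 2$ matrices. To a polynomial $p(z)=a_kz^k+\dots+a_1z+a_0$ with complex coefficients of degree $k\ge 2$ associate the matrix-valued polynomial $P:\mathcal{M}(2,\mathbb{C})\to\mathcal{M}(2,\mathbb{C})$, $P(M)=a_kM^k+\dots+a_1M+a_0I$. The Fatou set $F_P$ is the set of those $M$ that have an open neighbourhood on which the family of iterates $\{P^n\}_{n\ge1}$ is normal, i.e. every sequence in the family has a subsequence that either converges uniformly on compact subsets or diverges to infinity uniformly on compact subsets of this neighbourhood; the Julia set is $J_P=\mathcal{M}(2,\mathbb{C})\setminus F_P$. Let $P$ and $Q$ be the matrix-valued polynomials associated with complex polynomials $p$ and $q$, both of degree at least $2$. (1) If $P\circ Q=Q\circ P$, then $J_P=J_Q$. (2) Conversely, if $J_P=J_Q$, then there exist $a,b\in\mathbb{C}$ with $|a|=1$ such that $P\circ Q=\Sigma\circ Q\circ P$, where $\Sigma(M)=aM+bI$ for all $M\in\mathcal{M}(2,\mathbb{C})$. -/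

import Mathlib

open Polynomial Filter Topology

/-- A family of maps `F i : E → E` is normal on `U`: every sequence of members of the family has a
subsequence which, uniformly on every compact subset of `U`, either converges to some map `g`
or diverges to infinity, i.e. eventually leaves every compact subset of `E`.
(For holomorphic `F i` on an open set `U` the limit `g` is automatically holomorphic on `U`.) -/
def IsNormalFamilyOn {ι E : Type*} [UniformSpace E] (F : ι → E → E) (U : Set E) : Prop :=
  ∀ s : ℕ → ι, ∃ φ : ℕ → ℕ, StrictMono φ ∧
    ((∃ g : E → E, ∀ K ⊆ U, IsCompact K →
        TendstoUniformlyOn (fun k => F (s (φ k))) g atTop K) ∨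
      (∀ K ⊆ U, IsCompact K → ∀ C : Set E, IsCompact C →
        ∀ᶠ k in atTop, ∀ x ∈ K, F (s (φ k)) x ∉ C))

/-- The Fatou set of `f`: the points having an open neighbourhood on which the iterates `f^n`,
`n ≥ 1`, form a normal family. -/
def fatouSet {E : Type*} [UniformSpace E] (f : E → E) : Set E :=
  {x | ∃ U : Set E, IsOpen U ∧ x ∈ U ∧ IsNormalFamilyOn (fun n : ℕ => f^[n + 1]) U}

/-- The Julia set of `f`: the complement of the Fatou set. -/
def juliaSet {E : Type*} [UniformSpace E] (f : E → E) : Set E :=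
  (fatouSet f)ᶜ

/-- The matrix-valued polynomial `M ↦ a_k M^k + ⋯ + a_1 M + a_0 I` on the space of complex
`2 × 2` matrices corresponding to the polynomial `p = a_k X^k + ⋯ + a_1 X + a_0`. -/
noncomputable def matrixPoly (p : ℂ[X]) (M : Matrix (Fin 2) (Fin 2) ℂ) :
    Matrix (Fin 2) (Fin 2) ℂ :=
  ∑ i ∈ Finset.range (p.natDegree + 1), p.coeff i • M ^ i

/-!
A matrix `M` with eigenvalues `a` and `b` satisfies `f(M) = f(a) I + f[a, b] (M - a I)`, where
`f[a, b]` is a divided difference. Let `K` be the filled Julia set of `p`. An eigenvalue outside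
`K` drives a whole neighbourhood of `M` to infinity, and two eigenvalues in the interior of `K` make
the iterates locally bounded, hence normal. So `J_P` consists of the matrices with both eigenvalues
in `K` and at least one on its boundary, and `J_P = J_Q` holds if and only if `p` and `q` have the
same filled Julia set `K`.

If `p` and `q` commute, then `q` maps the bounded set `K` into itself, so the filled Julia set of
`q` contains `K`; by symmetry they are equal. Conversely, a common filled Julia set determines a
common Green function `G`, with `G ∘ p = deg p * G` and `G ∘ q = deg q * G`. Hence
`G ∘ p ∘ q = deg p * deg q * G = G ∘ q ∘ p`. Since `G z = log |z - c| + const + O(|z|⁻²)` at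
infinity, with a centre `c` depending only on `G`, the polynomials `u = p ∘ q - c` and
`v = q ∘ p - c` satisfy `|u|² - |v|² = O(1)`, and comparing coefficients gives `u = a v` with
`|a| = 1`.
-/

section FilledJuliaSet

variable {E : Type*}

/-- The filled Julia set of `f`: the points whose forward orbit under `f` is bounded. -/
def filledJuliaSet [Bornology E] (f : E → E) : Set E :=
  {x | Bornology.IsBounded (Set.range fun n : ℕ => f^[n] x)}

theorem map_mem_filledJuliaSet_iff [Bornology E] {f : E → E} {x : E} :
    f x ∈ filledJuliaSet f ↔ x ∈ filledJuliaSet f := by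
  have h : Set.range (fun n : ℕ => f^[n] x) = insert x (Set.range fun n : ℕ => f^[n] (f x)) :=
    (Nat.range_of_succ _).symm
  simp only [filledJuliaSet, Set.mem_ofPred_eq, h, Bornology.isBounded_insert]

theorem iterate_mem_filledJuliaSet_iff [Bornology E] {f : E → E} {x : E} (n : ℕ) :
    f^[n] x ∈ filledJuliaSet f ↔ x ∈ filledJuliaSet f := by
  induction n with
  | zero => rfl
  | succ n ih => rw [Function.iterate_succ_apply', map_mem_filledJuliaSet_iff, ih]

theorem filledJuliaSet_subset_of_commute [PseudoMetricSpace E] [ProperSpace E] {f g : E → E}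
    (hg : Continuous g) (hfg : Function.Commute f g) (hf : Bornology.IsBounded (filledJuliaSet f)) :
    filledJuliaSet f ⊆ filledJuliaSet g := by
  have hmaps : Set.MapsTo g (filledJuliaSet f) (filledJuliaSet f) := fun x hx => by
    refine (hx.isCompact_closure.image hg).isBounded.subset ?_
    rintro _ ⟨n, rfl⟩
    exact ⟨f^[n] x, subset_closure ⟨n, rfl⟩, (hfg.iterate_left n x).symm⟩
  exact fun x hx => hf.subset (Set.range_subset_iff.2 fun n => hmaps.iterate n hx)

theorem mem_filledJuliaSet_of_norm_iterate_le [SeminormedAddCommGroup E] {f : E → E} {x : E} {B : ℝ}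
    (h : ∀ n, ‖f^[n] x‖ ≤ B) : x ∈ filledJuliaSet f :=
  isBounded_iff_forall_norm_le.2 ⟨B, Set.forall_mem_range.2 h⟩

/-- `R` is an escape radius of `f` if `f` at least doubles the norm of every point outside the
ball of radius `R ≥ 1`. -/
structure IsEscapeRadius [NormedAddCommGroup E] (f : E → E) (R : ℝ) : Prop where
  one_le : 1 ≤ R
  two_mul_norm_le : ∀ x, R < ‖x‖ → 2 * ‖x‖ ≤ ‖f x‖

namespace IsEscapeRadius

variable [NormedAddCommGroup E] {f : E → E} {R : ℝ} {x : E}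

theorem mono {S : ℝ} (hR : IsEscapeRadius f R) (hRS : R ≤ S) : IsEscapeRadius f S :=
  ⟨hR.one_le.trans hRS, fun x hx => hR.two_mul_norm_le x (hRS.trans_lt hx)⟩

theorem two_pow_mul_norm_le_norm_iterate (hR : IsEscapeRadius f R) (hx : R < ‖x‖) (n : ℕ) :
    2 ^ n * ‖x‖ ≤ ‖f^[n] x‖ := by
  induction n with
  | zero => simp
  | succ n ih =>
    have hn : R < ‖f^[n] x‖ :=
      hx.trans_le ((le_mul_of_one_le_left (norm_nonneg x) (one_le_pow₀ one_le_two)).trans ih)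
    calc 2 ^ (n + 1) * ‖x‖ = 2 * (2 ^ n * ‖x‖) := by ring
      _ ≤ 2 * ‖f^[n] x‖ := by gcongr
      _ ≤ ‖f (f^[n] x)‖ := hR.two_mul_norm_le _ hn
      _ = ‖f^[n + 1] x‖ := by rw [Function.iterate_succ_apply']

theorem norm_le_norm_iterate (hR : IsEscapeRadius f R) (hx : R < ‖x‖) (n : ℕ) :
    ‖x‖ ≤ ‖f^[n] x‖ :=
  (le_mul_of_one_le_left (norm_nonneg x) (one_le_pow₀ one_le_two)).trans
    (hR.two_pow_mul_norm_le_norm_iterate hx n)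

theorem lt_norm_iterate_of_le {m n : ℕ} (hR : IsEscapeRadius f R) (hx : R < ‖f^[m] x‖)
    (hmn : m ≤ n) : R < ‖f^[n] x‖ := by
  obtain ⟨k, rfl⟩ := Nat.exists_eq_add_of_le' hmn
  rw [Function.iterate_add_apply]
  exact hx.trans_le (hR.norm_le_norm_iterate hx k)

theorem mem_filledJuliaSet_iff (hR : IsEscapeRadius f R) :
    x ∈ filledJuliaSet f ↔ ∀ n, ‖f^[n] x‖ ≤ R := by
  refine ⟨fun hx n => ?_, mem_filledJuliaSet_of_norm_iterate_le⟩
  by_contra! hn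
  obtain ⟨B, hB⟩ := isBounded_iff_forall_norm_le.1 ((iterate_mem_filledJuliaSet_iff n).2 hx)
  obtain ⟨m, hm⟩ := pow_unbounded_of_one_lt B (one_lt_two (α := ℝ))
  have hle : (2 : ℝ) ^ m ≤ 2 ^ m * ‖f^[n] x‖ :=
    le_mul_of_one_le_right (by positivity) (hR.one_le.trans hn.le)
  linarith [hR.two_pow_mul_norm_le_norm_iterate hn m, hB _ ⟨m, rfl⟩]

theorem norm_le_of_mem_filledJuliaSet (hR : IsEscapeRadius f R) (hx : x ∈ filledJuliaSet f) :
    ‖x‖ ≤ R :=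
  hR.mem_filledJuliaSet_iff.1 hx 0

theorem isBounded_filledJuliaSet (hR : IsEscapeRadius f R) :
    Bornology.IsBounded (filledJuliaSet f) :=
  isBounded_iff_forall_norm_le.2 ⟨R, fun _ => hR.norm_le_of_mem_filledJuliaSet⟩

theorem isClosed_filledJuliaSet (hR : IsEscapeRadius f R) (hf : Continuous f) :
    IsClosed (filledJuliaSet f) := by
  have h : filledJuliaSet f = ⋂ n, {x | ‖f^[n] x‖ ≤ R} := by
    ext x; simp only [hR.mem_filledJuliaSet_iff, Set.mem_iInter, Set.mem_ofPred_eq]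
  rw [h]
  exact isClosed_iInter fun n => isClosed_le (hf.iterate n).norm continuous_const

theorem eventually_forall_lt_norm_iterate (hR : IsEscapeRadius f R) (hf : Continuous f) {L : Set E}
    (hL : IsCompact L) (hd : Disjoint L (filledJuliaSet f)) :
    ∀ᶠ n in atTop, ∀ x ∈ L, R < ‖f^[n] x‖ := by
  obtain ⟨m, hm⟩ := hL.elim_directed_cover (fun n => {x | R < ‖f^[n] x‖})
    (fun n => isOpen_lt continuous_const (hf.iterate n).norm)
    (fun x hx => by
      simpa [hR.mem_filledJuliaSet_iff] using Set.disjoint_left.1 hd hx)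
    (directed_of_isDirected_le fun _ _ hij _ hx => hR.lt_norm_iterate_of_le hx hij)
  filter_upwards [eventually_ge_atTop m] with n hn x hx
  exact hR.lt_norm_iterate_of_le (hm hx) hn

end IsEscapeRadius

end FilledJuliaSet

section PolynomialFilledJuliaSet

variable {p : ℂ[X]}

theorem eval_iterate_comp_X {R : Type*} [CommSemiring R] (p : R[X]) (n : ℕ) (z : R) :
    (p.comp^[n] X).eval z = (p.eval ·)^[n] z := by
  rw [iterate_comp_eval, eval_X]

theorem exists_isEscapeRadius (hp : 2 ≤ p.natDegree) : ∃ R, IsEscapeRadius (p.eval ·) R := by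
  have hdeg : 0 < p.divX.degree := by
    rw [← natDegree_pos_iff_degree_pos, natDegree_divX_eq_natDegree_tsub_one]; omega
  have hlarge : ∀ᶠ z in Bornology.cobounded ℂ, 3 ≤ ‖p.divX.eval z‖ :=
    (p.divX.tendsto_norm_atTop hdeg tendsto_norm_cobounded_atTop).eventually_ge_atTop 3
  obtain ⟨R, -, hR⟩ := Filter.hasBasis_cobounded_norm.eventually_iff.1 hlarge
  refine ⟨max (max 1 R) ‖p.coeff 0‖, by simp, fun z hz => ?_⟩
  simp only [max_lt_iff] at hz
  have heval : p.divX.eval z * z = p.eval z - p.coeff 0 := by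
    conv_rhs => rw [← divX_mul_X_add p]
    simp
  have hmul : 3 * ‖z‖ ≤ ‖p.divX.eval z * z‖ := by
    rw [norm_mul]; gcongr; exact hR hz.1.2.le
  have hsub : ‖p.divX.eval z * z‖ ≤ ‖p.eval z‖ + ‖p.coeff 0‖ := heval ▸ norm_sub_le _ _
  linarith [hz.2]

theorem isBounded_filledJuliaSet_eval (hp : 2 ≤ p.natDegree) :
    Bornology.IsBounded (filledJuliaSet (p.eval ·)) :=
  (exists_isEscapeRadius hp).choose_spec.isBounded_filledJuliaSet

theorem isClosed_filledJuliaSet_eval (hp : 2 ≤ p.natDegree) :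
    IsClosed (filledJuliaSet (p.eval ·)) :=
  (exists_isEscapeRadius hp).choose_spec.isClosed_filledJuliaSet p.continuous

theorem eventually_forall_lt_norm_iterate_eval (hp : 2 ≤ p.natDegree) {L : Set ℂ}
    (hL : IsCompact L) (hd : Disjoint L (filledJuliaSet (p.eval ·))) (B : ℝ) :
    ∀ᶠ n in atTop, ∀ z ∈ L, B < ‖(p.eval ·)^[n] z‖ := by
  obtain ⟨R, hR⟩ := exists_isEscapeRadius hp
  filter_upwards [(hR.mono (le_max_left R B)).eventually_forall_lt_norm_iterate p.continuous hL hd]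
    with n hn z hz
  exact (le_max_right R B).trans_lt (hn z hz)

theorem subset_filledJuliaSet_eval_of_frontier_subset (hp : 2 ≤ p.natDegree) {S : Set ℂ}
    (hS : Bornology.IsBounded S) (h : frontier S ⊆ filledJuliaSet (p.eval ·)) :
    S ⊆ filledJuliaSet (p.eval ·) := by
  obtain ⟨R, hR⟩ := exists_isEscapeRadius hp
  intro z hz
  exact hR.mem_filledJuliaSet_iff.2 fun n =>
    Complex.norm_le_of_forall_mem_frontier_norm_le hS (p.differentiable.iterate n).diffContOnCl
      (fun w hw => hR.mem_filledJuliaSet_iff.1 (h hw) n) (subset_closure hz)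

theorem eval_derivative_eq_zero_of_forall_isRoot_eq {k : Type*} [Field k] [IsAlgClosed k]
    {f : k[X]} {c : k} (hf : 2 ≤ f.natDegree) (h : ∀ z, f.IsRoot z → z = c) :
    f.derivative.eval c = 0 := by
  classical
  have hf0 : f ≠ 0 := by rintro rfl; simp at hf
  have hroots : f.roots = Multiset.replicate f.natDegree c :=
    Multiset.eq_replicate.2
      ⟨(IsAlgClosed.splits f).natDegree_eq_card_roots.symm,
        fun z hz => h z (isRoot_of_mem_roots hz)⟩
  have hmult : 1 < f.rootMultiplicity c := by
    rwa [← count_roots, hroots, Multiset.count_replicate_self]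
  exact ((one_lt_rootMultiplicity_iff_isRoot hf0).1 hmult).2

/-- If the filled Julia set were `{c}`, all fixed points and all preimages of `c` would equal `c`,
and the derivative at `c` would be both `1` and `0`. -/
theorem nontrivial_filledJuliaSet_eval (hp : 2 ≤ p.natDegree) :
    (filledJuliaSet (p.eval ·)).Nontrivial := by
  have hfix : ∀ z, (p - X).IsRoot z → p.eval z = z := fun z hz => by
    simpa [sub_eq_zero] using hz
  have hmem : ∀ z, p.eval z = z → z ∈ filledJuliaSet (p.eval ·) := fun z hz => by
    have hconst : ∀ n, (p.eval ·)^[n] z = z := fun n => Function.iterate_fixed hz n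
    simp [filledJuliaSet, hconst]
  have hdegX : (p - X).natDegree = p.natDegree :=
    natDegree_sub_eq_left_of_natDegree_lt (by rw [natDegree_X]; omega)
  obtain ⟨c, hc⟩ := IsAlgClosed.exists_root (p - X)
    (degree_ne_of_natDegree_ne (n := 0) (by omega))
  by_contra htriv
  have hsub := Set.not_nontrivial_iff.1 htriv
  have heq : ∀ z ∈ filledJuliaSet (p.eval ·), z = c := fun z hz => hsub hz (hmem c (hfix c hc))
  have hone : (p - X).derivative.eval c = 0 :=
    eval_derivative_eq_zero_of_forall_isRoot_eq (hdegX ▸ hp) fun z hz => heq z (hmem z (hfix z hz))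
  have hzero : (p - C c).derivative.eval c = 0 := by
    refine eval_derivative_eq_zero_of_forall_isRoot_eq (by rwa [natDegree_sub_C]) fun z hz => ?_
    have hz' : p.eval z = c := by simpa [sub_eq_zero] using hz
    exact heq z (map_mem_filledJuliaSet_iff.1 (hz' ▸ hmem c (hfix c hc)))
  simp_all

/-- Near an isolated point `a` the function `1 / (p^n - w)`, with `w ≠ p^n a` another point of the
filled Julia set, would have no pole, and would violate the maximum principle. -/
theorem preperfect_filledJuliaSet_eval (hp : 2 ≤ p.natDegree) :
    Preperfect (filledJuliaSet (p.eval ·)) := by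
  intro a ha
  by_contra hacc
  obtain ⟨r, hr, hiso⟩ : ∃ r > 0, ∀ z ∈ Metric.closedBall a r,
      z ∈ filledJuliaSet (p.eval ·) → z = a := by
    simp only [accPt_iff_nhds, not_forall, not_exists, not_and, not_not] at hacc
    obtain ⟨U, hU, hUa⟩ := hacc
    obtain ⟨r, hr, hrU⟩ := Metric.nhds_basis_closedBall.mem_iff.1 hU
    exact ⟨r, hr, fun z hz hzK => hUa z ⟨hrU hz, hzK⟩⟩
  have hdisj : Disjoint (Metric.sphere a r) (filledJuliaSet (p.eval ·)) :=
    Set.disjoint_left.2 fun z hz hzK =>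
      Metric.ne_of_mem_sphere hz hr.ne' (hiso z (Metric.sphere_subset_closedBall hz) hzK)
  obtain ⟨R, hR⟩ := exists_isEscapeRadius hp
  have hR0 : 0 < R := one_pos.trans_le hR.one_le
  obtain ⟨n, hn⟩ :=
    (eventually_forall_lt_norm_iterate_eval hp (isCompact_sphere a r) hdisj (4 * R)).exists
  obtain ⟨w, hw, hwa⟩ := (nontrivial_filledJuliaSet_eval hp).exists_ne ((p.eval ·)^[n] a)
  have hne : ∀ z ∈ Metric.closedBall a r, (p.eval ·)^[n] z - w ≠ 0 := fun z hz hzw => by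
    have hzw' := sub_eq_zero.1 hzw
    have hza := hiso z hz ((iterate_mem_filledJuliaSet_iff n).1 (hzw' ▸ hw))
    exact hwa (hza ▸ hzw'.symm)
  have hdiff : DiffContOnCl ℂ (fun z => ((p.eval ·)^[n] z - w)⁻¹) (Metric.ball a r) :=
    ((p.differentiable.iterate n).diffContOnCl.sub_const w).inv fun z hz =>
      hne z (Metric.closure_ball_subset_closedBall hz)
  have hwR : ‖w‖ ≤ R := hR.norm_le_of_mem_filledJuliaSet hw
  have hmax : ‖((p.eval ·)^[n] a - w)⁻¹‖ ≤ (3 * R)⁻¹ := by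
    refine Complex.norm_le_of_forall_mem_frontier_norm_le Metric.isBounded_ball hdiff
      (fun z hz => ?_) (subset_closure (Metric.mem_ball_self hr))
    rw [norm_inv]
    gcongr
    linarith [hn z (Metric.frontier_ball_subset_sphere hz),
      norm_sub_norm_le ((p.eval ·)^[n] z) w]
  have hpos : 0 < ‖(p.eval ·)^[n] a - w‖ := norm_pos_iff.2 (sub_ne_zero.2 hwa.symm)
  rw [norm_inv, inv_le_inv₀ hpos (by positivity)] at hmax
  linarith [hR.mem_filledJuliaSet_iff.1 ha n, norm_sub_le ((p.eval ·)^[n] a) w]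

end PolynomialFilledJuliaSet

section GreenFunction

open Asymptotics Bornology
open scoped Real

theorem exists_tendsto_div_pow_of_abs_sub_le {α : Type*} {T : α → α} {u : α → ℝ} {d C : ℝ}
    (hd : 1 < d) (h : ∀ x, |u (T x) - d * u x| ≤ C) (x : α) :
    ∃ g, Tendsto (fun n => u (T^[n] x) / d ^ n) atTop (𝓝 g) ∧ |g - u x| ≤ C / (d - 1) := by
  have hd0 : 0 < d := one_pos.trans hd
  have hd1 : d - 1 ≠ 0 := by linarith
  have hstep : ∀ n, dist (u (T^[n] x) / d ^ n) (u (T^[n + 1] x) / d ^ (n + 1)) ≤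
      C / d * d⁻¹ ^ n := fun n => by
    have hdiff : u (T^[n + 1] x) / d ^ (n + 1) - u (T^[n] x) / d ^ n =
        (u (T (T^[n] x)) - d * u (T^[n] x)) / d ^ (n + 1) := by
      rw [Function.iterate_succ_apply', pow_succ]; field_simp
    rw [dist_comm, Real.dist_eq, hdiff, abs_div, abs_of_pos (pow_pos hd0 _)]
    calc |u (T (T^[n] x)) - d * u (T^[n] x)| / d ^ (n + 1) ≤ C / d ^ (n + 1) := by gcongr; exact h _
      _ = C / d * d⁻¹ ^ n := by rw [inv_pow, pow_succ]; field_simp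
  obtain ⟨g, hg⟩ := cauchySeq_tendsto_of_complete
    (cauchySeq_of_le_geometric _ _ (inv_lt_one_of_one_lt₀ hd) hstep)
  refine ⟨g, hg, ?_⟩
  calc |g - u x| = dist (u (T^[0] x) / d ^ 0) g := by simp [Real.dist_eq, abs_sub_comm]
    _ ≤ C / d / (1 - d⁻¹) :=
      dist_le_of_le_geometric_of_tendsto₀ _ _ (inv_lt_one_of_one_lt₀ hd) hstep hg
    _ = C / (d - 1) := by field_simp

theorem exists_forall_norm_le_of_isBigO_cobounded_one {E F : Type*} [PseudoMetricSpace E]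
    [ProperSpace E] [SeminormedAddCommGroup F] {f : E → F} (hf : Continuous f)
    (h : f =O[cobounded E] (1 : E → ℝ)) : ∃ C, ∀ x, ‖f x‖ ≤ C := by
  obtain ⟨B, hB⟩ := h.bound
  simp only [Pi.one_apply, norm_one, mul_one, Metric.cobounded_eq_cocompact] at hB
  obtain ⟨K, hK, hKB⟩ := Filter.mem_cocompact.1 hB
  obtain ⟨A, hA⟩ := hK.exists_bound_of_continuousOn hf.continuousOn
  refine ⟨max A B, fun x => ?_⟩
  by_cases hx : x ∈ K
  · exact (hA x hx).trans (le_max_left A B)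
  · exact le_max_of_le_right (hKB hx)

theorem exists_eventually_posLog_norm_le_of_isBigO {α E F : Type*} [SeminormedAddCommGroup E]
    [SeminormedAddCommGroup F] {f : α → E} {g : α → F} {l : Filter α} (h : f =O[l] g) :
    ∃ C, ∀ᶠ x in l, log⁺ ‖f x‖ ≤ C + log⁺ ‖g x‖ := by
  obtain ⟨B, hB⟩ := h.bound
  refine ⟨log⁺ B, hB.mono fun x hx => ?_⟩
  exact (Real.posLog_le_posLog (norm_nonneg _) hx).trans Real.posLog_mul

theorem posLog_norm_sub_isBigO_one_of_isTheta {α E F : Type*} [SeminormedAddCommGroup E]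
    [SeminormedAddCommGroup F] {f : α → E} {g : α → F} {l : Filter α} (h : f =Θ[l] g) :
    (fun x => log⁺ ‖f x‖ - log⁺ ‖g x‖) =O[l] (1 : α → ℝ) := by
  obtain ⟨A, hA⟩ := exists_eventually_posLog_norm_le_of_isBigO h.1
  obtain ⟨B, hB⟩ := exists_eventually_posLog_norm_le_of_isBigO h.2
  refine IsBigO.of_bound (max A B) ?_
  filter_upwards [hA, hB] with x hxA hxB
  rw [Pi.one_apply, norm_one, mul_one, Real.norm_eq_abs, abs_sub_le_iff]
  exact ⟨by linarith [le_max_left A B], by linarith [le_max_right A B]⟩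

theorem eval_isTheta_pow_natDegree {p : ℂ[X]} (hp : p ≠ 0) :
    (p.eval ·) =Θ[cobounded ℂ] (· ^ p.natDegree) :=
  isEquivalent_cobounded_leading_monomial.isTheta.trans
    ((isTheta_const_mul_left (leadingCoeff_ne_zero.2 hp)).2 isTheta_rfl)

theorem exists_abs_posLog_norm_eval_sub_le {p : ℂ[X]} (hp : p ≠ 0) :
    ∃ C, ∀ z, |log⁺ ‖p.eval z‖ - p.natDegree * log⁺ ‖z‖| ≤ C := by
  have h := posLog_norm_sub_isBigO_one_of_isTheta (eval_isTheta_pow_natDegree hp)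
  simp only [norm_pow, Real.posLog_pow] at h
  have hcont : Continuous fun z => log⁺ ‖p.eval z‖ - p.natDegree * log⁺ ‖z‖ := by fun_prop
  exact exists_forall_norm_le_of_isBigO_cobounded_one hcont h

/-- The Green function of the filled Julia set of `p`, with pole at infinity, as the escape rate
`lim log⁺ |pⁿ z| / dⁿ`, where `d` is the degree of `p`. -/
noncomputable def green (p : ℂ[X]) (z : ℂ) : ℝ :=
  limUnder atTop fun n : ℕ => log⁺ ‖(p.eval ·)^[n] z‖ / (p.natDegree : ℝ) ^ n

section

variable {p : ℂ[X]} (hp : 2 ≤ p.natDegree)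
include hp

theorem tendsto_green (z : ℂ) :
    Tendsto (fun n : ℕ => log⁺ ‖(p.eval ·)^[n] z‖ / (p.natDegree : ℝ) ^ n) atTop
      (𝓝 (green p z)) := by
  obtain ⟨C, hC⟩ := exists_abs_posLog_norm_eval_sub_le (ne_zero_of_natDegree_gt hp)
  obtain ⟨g, hg, -⟩ := exists_tendsto_div_pow_of_abs_sub_le (u := fun z => log⁺ ‖z‖)
    (by exact_mod_cast hp) hC z
  exact tendsto_nhds_limUnder ⟨g, hg⟩

theorem exists_abs_green_sub_posLog_le : ∃ C, ∀ z, |green p z - log⁺ ‖z‖| ≤ C := by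
  obtain ⟨C, hC⟩ := exists_abs_posLog_norm_eval_sub_le (ne_zero_of_natDegree_gt hp)
  refine ⟨C / (p.natDegree - 1), fun z => ?_⟩
  obtain ⟨g, hg, hgC⟩ := exists_tendsto_div_pow_of_abs_sub_le (u := fun z => log⁺ ‖z‖)
    (by exact_mod_cast hp) hC z
  rwa [tendsto_nhds_unique (tendsto_green hp z) hg]

theorem green_nonneg (z : ℂ) : 0 ≤ green p z :=
  ge_of_tendsto' (tendsto_green hp z) fun _ => div_nonneg Real.posLog_nonneg (by positivity)

theorem green_eval (z : ℂ) : green p (p.eval z) = p.natDegree * green p z := by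
  have hshift := ((tendsto_green hp z).comp (tendsto_add_atTop_nat 1)).const_mul (p.natDegree : ℝ)
  refine tendsto_nhds_unique (tendsto_green hp _) (hshift.congr fun n => ?_)
  have hd : (p.natDegree : ℝ) ≠ 0 := by positivity
  simp only [Function.comp_apply, Function.iterate_succ_apply, pow_succ]
  field_simp

end

theorem norm_le_of_forall_mem_frontier_norm_le_of_cobounded {E F : Type*} [NormedAddCommGroup E]
    [NormedSpace ℂ E] [Nontrivial E] [NormedAddCommGroup F] [NormedSpace ℂ F] {f : E → F}
    {U : Set E} {C : ℝ} (hd : DiffContOnCl ℂ f U) (hC : ∀ z ∈ frontier U, ‖f z‖ ≤ C)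
    (hinf : ∀ᶠ z in cobounded E, ‖f z‖ ≤ C) {z : E} (hz : z ∈ closure U) : ‖f z‖ ≤ C := by
  obtain ⟨R, -, hR⟩ := hasBasis_cobounded_norm.eventually_iff.1 hinf
  rcases le_or_gt R ‖z‖ with hzR | hzR
  · exact hR hzR
  refine Complex.norm_le_of_forall_mem_frontier_norm_le
    (Metric.isBounded_ball.subset Set.inter_subset_right) (hd.mono Set.inter_subset_left)
    (fun w hw => ?_)
    (Metric.isOpen_ball.closure_inter ⟨hz, mem_ball_zero_iff.2 hzR⟩)
  rcases frontier_inter_subset _ _ hw with hw | hw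
  · exact hC w hw.1
  · exact hR (mem_sphere_zero_iff_norm.1 (Metric.frontier_ball_subset_sphere hw.2)).ge

/-- The Bernstein–Walsh inequality for the lemniscate `|P| ≤ R`. -/
theorem norm_eval_pow_mul_pow_le_of_lemniscate {f P : ℂ[X]} {m : ℕ} {M R : ℝ}
    (hP : 0 < P.natDegree) (hfm : f.natDegree < m) (hM : 0 < M) (hR : 0 < R)
    (hf : ∀ z, ‖P.eval z‖ ≤ R → ‖f.eval z‖ ≤ M) {z : ℂ} (hz : R < ‖P.eval z‖) :
    ‖f.eval z‖ ^ P.natDegree * R ^ m ≤ M ^ P.natDegree * ‖P.eval z‖ ^ m := by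
  set D := P.natDegree
  set U := {w | R < ‖P.eval w‖}
  have hclosure : ∀ w ∈ closure U, R ≤ ‖P.eval w‖ := fun w hw =>
    closure_lt_subset_le continuous_const P.continuous.norm hw
  have hd : DiffContOnCl ℂ (fun w => (f ^ D).eval w / (P ^ m).eval w) U := by
    have hinv := ((P ^ m).differentiable.diffContOnCl (s := U)).inv fun w hw => by
      rw [eval_pow]
      exact pow_ne_zero _ (norm_pos_iff.1 (hR.trans_le (hclosure w hw)))
    exact (f ^ D).differentiable.diffContOnCl.smul hinv
  have hdeg : (f ^ D).degree < (P ^ m).degree := by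
    refine degree_lt_degree ?_
    rw [natDegree_pow, natDegree_pow, mul_comm]
    exact Nat.mul_lt_mul_of_pos_right hfm hP
  have hinf : ∀ᶠ w in cobounded ℂ, ‖(f ^ D).eval w / (P ^ m).eval w‖ ≤ M ^ D / R ^ m :=
    (isLittleO_cobounded_of_degree_lt hdeg).tendsto_div_nhds_zero.norm.eventually_le_const
      (by simp only [norm_zero]; positivity)
  have hfrontier : ∀ w ∈ frontier U, ‖(f ^ D).eval w / (P ^ m).eval w‖ ≤ M ^ D / R ^ m := by
    intro w hw
    have hwR : R = ‖P.eval w‖ := frontier_lt_subset_eq continuous_const P.continuous.norm hw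
    rw [eval_pow, eval_pow, norm_div, norm_pow, norm_pow, ← hwR]
    gcongr
    exact hf w hwR.ge
  have hmax := norm_le_of_forall_mem_frontier_norm_le_of_cobounded hd hfrontier hinf
    (subset_closure hz)
  rwa [eval_pow, eval_pow, norm_div, norm_pow, norm_pow,
    div_le_div_iff₀ (pow_pos (hR.trans hz) m) (by positivity)] at hmax

theorem eventually_forall_norm_iterate_le_imp_mem {p : ℂ[X]} (hp : 2 ≤ p.natDegree) {V : Set ℂ}
    (hV : IsOpen V) (hKV : filledJuliaSet (p.eval ·) ⊆ V) (B : ℝ) :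
    ∀ᶠ n in atTop, ∀ z, ‖(p.eval ·)^[n] z‖ ≤ B → z ∈ V := by
  obtain ⟨R, hR⟩ := exists_isEscapeRadius hp
  have hdisj : Disjoint (Metric.closedBall 0 (max R B) \ V) (filledJuliaSet (p.eval ·)) :=
    Set.disjoint_left.2 fun z hz hzK => hz.2 (hKV hzK)
  filter_upwards [eventually_forall_lt_norm_iterate_eval hp
    ((isCompact_closedBall _ _).diff hV) hdisj B] with n hn z hz
  by_contra hzV
  rcases le_or_gt ‖z‖ (max R B) with hzR | hzR
  · exact (hn z ⟨mem_closedBall_zero_iff.2 hzR, hzV⟩).not_ge hz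
  · exact absurd (hR.norm_le_norm_iterate ((le_max_left R B).trans_lt hzR) n)
      (hz.trans_lt ((le_max_right R B).trans_lt hzR)).not_ge

theorem mul_exp_mul_posLog_div_pow {M x : ℝ} {m n : ℕ} (hx : 1 ≤ x) (hn : n ≠ 0) :
    (M * Real.exp (m * (log⁺ x / n))) ^ n = M ^ n * x ^ m := by
  have hcancel : (n : ℝ) * (m * (log⁺ x / n)) = m * log⁺ x := by field_simp
  rw [mul_pow, ← Real.exp_nat_mul, hcancel, Real.exp_nat_mul,
    Real.posLog_eq_log (hx.trans (le_abs_self x)), Real.exp_log (one_pos.trans_le hx)]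

/-- The Bernstein–Walsh inequality for the filled Julia set, which is the limit of the lemniscates
`|pⁿ| ≤ R`. -/
theorem norm_eval_le_mul_exp_green {p f : ℂ[X]} {m : ℕ} {M : ℝ} (hp : 2 ≤ p.natDegree)
    (hfm : f.natDegree < m) (hf : ∀ z ∈ filledJuliaSet (p.eval ·), ‖f.eval z‖ < M) (z : ℂ) :
    ‖f.eval z‖ ≤ M * Real.exp (m * green p z) := by
  obtain ⟨R, hR⟩ := exists_isEscapeRadius hp
  have hM : 0 < M := by
    obtain ⟨w, hw⟩ := (nontrivial_filledJuliaSet_eval hp).nonempty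
    exact (norm_nonneg _).trans_lt (hf w hw)
  have hopen : IsOpen {w | ‖f.eval w‖ < M} := isOpen_lt f.continuous.norm continuous_const
  have hlim := ((tendsto_green hp z).const_mul (m : ℝ)).rexp.const_mul M
  refine ge_of_tendsto hlim ?_
  filter_upwards [eventually_forall_norm_iterate_le_imp_mem hp hopen hf R] with n hn
  rcases le_or_gt ‖(p.eval ·)^[n] z‖ R with hz | hz
  · calc ‖f.eval z‖ ≤ M := (hn z hz).le
      _ ≤ _ := le_mul_of_one_le_right hM.le (Real.one_le_exp (mul_nonneg m.cast_nonneg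
        (div_nonneg Real.posLog_nonneg (by positivity))))
  set P : ℂ[X] := p.comp^[n] X
  have hP : ∀ w, P.eval w = (p.eval ·)^[n] w := eval_iterate_comp_X p n
  have hD : P.natDegree = p.natDegree ^ n := by rw [natDegree_iterate_comp, natDegree_X, mul_one]
  have hD0 : p.natDegree ^ n ≠ 0 := pow_ne_zero _ (by omega)
  have hBW := norm_eval_pow_mul_pow_le_of_lemniscate (hD ▸ Nat.pos_of_ne_zero hD0) hfm hM
    (one_pos.trans_le hR.one_le) (fun w hw => (hn w (hP w ▸ hw)).le) (z := z) (hP z ▸ hz)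
  rw [hP, hD] at hBW
  refine le_of_pow_le_pow_left₀ hD0 (by positivity) ?_
  calc ‖f.eval z‖ ^ p.natDegree ^ n ≤ ‖f.eval z‖ ^ p.natDegree ^ n * R ^ m :=
        le_mul_of_one_le_right (by positivity) (one_le_pow₀ hR.one_le)
    _ ≤ M ^ p.natDegree ^ n * ‖(p.eval ·)^[n] z‖ ^ m := hBW
    _ = (M * Real.exp (m * (log⁺ ‖(p.eval ·)^[n] z‖ / (p.natDegree : ℝ) ^ n))) ^
        p.natDegree ^ n := by
      rw [← Nat.cast_pow, mul_exp_mul_posLog_div_pow (hR.one_le.trans hz.le) hD0]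

theorem green_le_green_of_filledJuliaSet_subset {p q : ℂ[X]} (hp : 2 ≤ p.natDegree)
    (hq : 2 ≤ q.natDegree) (h : filledJuliaSet (p.eval ·) ⊆ filledJuliaSet (q.eval ·)) (z : ℂ) :
    green q z ≤ green p z := by
  obtain ⟨R, hR⟩ := exists_isEscapeRadius hq
  have hR0 : 0 < R := one_pos.trans_le hR.one_le
  have hq1 : (1 : ℝ) < q.natDegree := by exact_mod_cast hq
  have hexp : ∀ n : ℕ, ‖(q.eval ·)^[n] z‖ ≤
      (R + 1) * Real.exp ((q.natDegree ^ n + 1 : ℕ) * green p z) := fun n => by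
    have hdeg : (q.comp^[n] X).natDegree < q.natDegree ^ n + 1 := by
      rw [natDegree_iterate_comp, natDegree_X, mul_one]; omega
    simpa only [eval_iterate_comp_X] using norm_eval_le_mul_exp_green hp hdeg
      (fun w hw => by
        rw [eval_iterate_comp_X]
        exact (hR.mem_filledJuliaSet_iff.1 (h hw) n).trans_lt (lt_add_one R)) z
  have hbound : ∀ n : ℕ, log⁺ ‖(q.eval ·)^[n] z‖ / (q.natDegree : ℝ) ^ n ≤
      (Real.log (R + 1) + green p z) / (q.natDegree : ℝ) ^ n + green p z := fun n => by
    have hge : 1 ≤ (R + 1) * Real.exp ((q.natDegree ^ n + 1 : ℕ) * green p z) :=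
      one_le_mul_of_one_le_of_one_le (by linarith)
        (Real.one_le_exp (mul_nonneg (Nat.cast_nonneg _) (green_nonneg hp z)))
    have hlog := Real.posLog_le_posLog (norm_nonneg _) (hexp n)
    rw [Real.posLog_eq_log (hge.trans (le_abs_self _)), Real.log_mul (by positivity)
      (Real.exp_ne_zero _), Real.log_exp] at hlog
    rw [div_add' _ _ _ (by positivity), div_le_div_iff_of_pos_right (by positivity)]
    push_cast at hlog
    linarith
  have hlim := ((tendsto_pow_atTop_atTop_of_one_lt hq1).const_div_atTop
    (Real.log (R + 1) + green p z)).add_const (green p z)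
  rw [zero_add] at hlim
  exact le_of_tendsto_of_tendsto' (tendsto_green hq z) hlim hbound

end GreenFunction

section GreenAtInfinity

open Asymptotics Bornology
open scoped Real ComplexConjugate

theorem exists_natDegree_sub_C_mul_X_sub_C_pow_le {k : Type*} [Field k] [CharZero k] (p : k[X]) :
    ∃ c, (p - C p.leadingCoeff * (X - C c) ^ p.natDegree).natDegree ≤ p.natDegree - 2 := by
  refine ⟨-p.coeff (p.natDegree - 1) / (p.leadingCoeff * p.natDegree), ?_⟩
  rw [natDegree_le_iff_coeff_eq_zero]
  intro N hN
  rw [coeff_sub, coeff_C_mul, sub_eq_add_neg X, ← C_neg, coeff_X_add_C_pow]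
  rcases lt_trichotomy N p.natDegree with h | rfl | h
  · obtain ⟨n, hn⟩ : ∃ n, p.natDegree = n + 1 := ⟨p.natDegree - 1, by omega⟩
    obtain rfl : N = n := by omega
    have hlead : p.leadingCoeff ≠ 0 := leadingCoeff_ne_zero.2 (ne_zero_of_natDegree_gt h)
    have hcast : (N : k) + 1 ≠ 0 := N.cast_add_one_ne_zero
    rw [hn, Nat.add_sub_cancel_left, Nat.add_sub_cancel, Nat.choose_succ_self_right]
    push_cast
    field_simp
    ring
  · simp
  · rw [coeff_eq_zero_of_natDegree_lt h, Nat.choose_eq_zero_of_lt h]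
    simp

theorem tendsto_inv_norm_sq_cobounded {E : Type*} [SeminormedAddCommGroup E] :
    Tendsto (fun z : E => (‖z‖ ^ 2)⁻¹) (cobounded E) (𝓝 0) :=
  ((tendsto_pow_atTop two_ne_zero).comp tendsto_norm_cobounded_atTop).inv_tendsto_atTop

theorem log_norm_isBigO_sub_one : (fun w : ℂ => Real.log ‖w‖) =O[𝓝 1] fun w => w - 1 := by
  have hlog := (Complex.differentiableAt_log Complex.one_mem_slitPlane).isBigO_sub
  simp only [Complex.log_one, sub_zero] at hlog
  refine .trans (.of_bound 1 (.of_forall fun w => ?_)) hlog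
  rw [one_mul, ← Complex.log_re]
  exact Complex.abs_re_le_norm _

theorem eventually_eval_ne_zero_cobounded {g : ℂ[X]} (hg : g ≠ 0) :
    ∀ᶠ z in cobounded ℂ, g.eval z ≠ 0 := by
  filter_upwards [(eval_isTheta_pow_natDegree hg).isBigO_symm.eq_zero_imp,
    eventually_ne_cobounded 0] with z hz hz0 h
  exact pow_ne_zero _ hz0 (hz h)

theorem eval_div_eval_sub_one_isBigO {f g : ℂ[X]} {n : ℕ} (hg : g ≠ 0)
    (h : (f - g).natDegree + n ≤ g.natDegree) :
    (fun z => f.eval z / g.eval z - 1) =O[cobounded ℂ] fun z => (‖z‖ ^ n)⁻¹ := by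
  have hdeg : ((f - g) * X ^ n).degree ≤ g.degree := by
    rw [degree_eq_natDegree hg]
    refine degree_le_of_natDegree_le (natDegree_mul_le.trans ?_)
    rwa [natDegree_X_pow]
  obtain ⟨B, hB0, hB⟩ := (isBigO_cobounded_of_degree_le hdeg).exists_nonneg
  refine IsBigO.of_bound B ?_
  filter_upwards [hB.bound, eventually_eval_ne_zero_cobounded hg, eventually_ne_cobounded 0]
    with z hz hgz hz0
  have hratio : f.eval z / g.eval z - 1 = ((f - g) * X ^ n).eval z / g.eval z / z ^ n := by
    simp only [eval_mul, eval_sub, eval_pow, eval_X]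
    field_simp
  rw [hratio, norm_div, norm_div, norm_inv, norm_pow, norm_pow, norm_norm, ← div_eq_mul_inv]
  gcongr
  exact div_le_of_le_mul₀ (norm_nonneg _) hB0 hz

theorem exists_log_norm_eval_sub_isBigO {p : ℂ[X]} (hp : 2 ≤ p.natDegree) :
    ∃ c, (fun z => Real.log ‖p.eval z - c‖ - p.natDegree * Real.log ‖z - c‖ -
      Real.log ‖p.leadingCoeff‖) =O[cobounded ℂ] fun z => (‖z‖ ^ 2)⁻¹ := by
  have hlead : p.leadingCoeff ≠ 0 := leadingCoeff_ne_zero.2 (ne_zero_of_natDegree_gt hp)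
  obtain ⟨c, hc⟩ := exists_natDegree_sub_C_mul_X_sub_C_pow_le p
  refine ⟨c, ?_⟩
  set g := C p.leadingCoeff * (X - C c) ^ p.natDegree
  have hg : ∀ z, g.eval z = p.leadingCoeff * (z - c) ^ p.natDegree := fun z => by simp [g]
  have hgdeg : g.natDegree = p.natDegree := by
    rw [natDegree_C_mul hlead, natDegree_pow, natDegree_X_sub_C, mul_one]
  have hg0 : g ≠ 0 := ne_zero_of_natDegree_gt (hgdeg ▸ hp)
  have hratio : (fun z => (p - C c).eval z / g.eval z - 1) =O[cobounded ℂ]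
      fun z => (‖z‖ ^ 2)⁻¹ :=
    eval_div_eval_sub_one_isBigO hg0 (by rw [sub_right_comm, natDegree_sub_C, hgdeg]; omega)
  have hone : Tendsto (fun z => (p - C c).eval z / g.eval z) (cobounded ℂ) (𝓝 1) :=
    tendsto_sub_nhds_zero_iff.1 (hratio.trans_tendsto tendsto_inv_norm_sq_cobounded)
  refine ((log_norm_isBigO_sub_one.comp_tendsto hone).trans hratio).congr' ?_ .rfl
  filter_upwards [eventually_eval_ne_zero_cobounded hg0, hone.eventually_ne one_ne_zero]
    with z hgz hz1
  have hnum : p.eval z - c ≠ 0 := fun h => hz1 (by rw [eval_sub, eval_C, h, zero_div])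
  have hpow : ‖(z - c) ^ p.natDegree‖ ≠ 0 :=
    norm_ne_zero_iff.2 (right_ne_zero_of_mul (hg z ▸ hgz))
  rw [Function.comp_apply, eval_sub, eval_C, norm_div, Real.log_div (norm_ne_zero_iff.2 hnum)
    (norm_ne_zero_iff.2 hgz), hg, norm_mul, Real.log_mul (norm_ne_zero_iff.2 hlead) hpow, norm_pow,
    Real.log_pow]
  ring

theorem IsEscapeRadius.isBigO_of_map_sub_isBigO {E : Type*} [NormedAddCommGroup E] {f : E → E}
    {R d : ℝ} (hR : IsEscapeRadius f R) {h w : E → ℝ} (hd : 2 ≤ d)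
    (hh : h =O[cobounded E] (1 : E → ℝ)) (hw : ∀ x, R < ‖x‖ → ‖w (f x)‖ ≤ ‖w x‖)
    (hsub : (fun x => h (f x) - d * h x) =O[cobounded E] w) : h =O[cobounded E] w := by
  obtain ⟨A, hA⟩ := hh.bound
  obtain ⟨B, hB0, hB⟩ := hsub.exists_nonneg
  obtain ⟨S, -, hS⟩ := hasBasis_cobounded_norm.eventually_iff.1 (hA.and hB.bound)
  simp only [Set.mem_ofPred_eq, Pi.one_apply, norm_one, mul_one] at hS
  have hT := hR.mono (le_max_left R S)
  have hiter : ∀ n x, max R S < ‖x‖ → ‖h x‖ ≤ B * ‖w x‖ + A * (1 / 2) ^ n := by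
    intro n
    induction n with
    | zero =>
      intro x hx
      have := (hS ((le_max_right R S).trans hx.le)).1
      rw [pow_zero, mul_one]
      exact this.trans (le_add_of_nonneg_left (by positivity))
    | succ n ih =>
      intro x hx
      have hfx := ih (f x) (hT.lt_norm_iterate_of_le (m := 0) (n := 1) hx zero_le_one)
      have hwx : B * ‖w (f x)‖ ≤ B * ‖w x‖ := by
        gcongr; exact hw x ((le_max_left R S).trans_lt hx)
      have hsubx := (hS ((le_max_right R S).trans hx.le)).2
      have hdh : 2 * ‖h x‖ ≤ ‖d * h x‖ := by
        rw [norm_mul]; gcongr; exact hd.trans (Real.le_norm_self d)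
      have htri : ‖d * h x‖ ≤ ‖h (f x)‖ + ‖h (f x) - d * h x‖ := norm_le_insert _ _
      rw [pow_succ]
      linarith
  refine IsBigO.of_bound B ?_
  filter_upwards [(tendsto_norm_cobounded_atTop (E := E)).eventually_gt_atTop (max R S)] with x hx
  have hlim := (tendsto_pow_atTop_nhds_zero_of_lt_one (r := (1 / 2 : ℝ)) (by norm_num)
    (by norm_num)).const_mul A |>.const_add (B * ‖w x‖)
  rw [mul_zero, add_zero] at hlim
  exact ge_of_tendsto' hlim fun n => hiter n x hx

theorem id_isTheta_sub_const_cobounded {E : Type*} [NormedAddCommGroup E] (c : E) :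
    (fun z => z) =Θ[cobounded E] fun z => z - c :=
  (IsEquivalent.refl.sub_isLittleO (isLittleO_const_id_cobounded c)).isTheta.symm

theorem green_sub_log_norm_sub_isBigO_one {p : ℂ[X]} (hp : 2 ≤ p.natDegree) (c : ℂ) :
    (fun z => green p z - Real.log ‖z - c‖) =O[cobounded ℂ] (1 : ℂ → ℝ) := by
  obtain ⟨C, hC⟩ := exists_abs_green_sub_posLog_le hp
  have hgreen : (fun z => green p z - log⁺ ‖z‖) =O[cobounded ℂ] (1 : ℂ → ℝ) :=
    .of_bound C (.of_forall fun z => by simpa using hC z)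
  have hlog := posLog_norm_sub_isBigO_one_of_isTheta (id_isTheta_sub_const_cobounded c)
  refine (hgreen.add hlog).congr' ?_ .rfl
  filter_upwards [(tendsto_norm_atTop_iff_cobounded.2
    (tendsto_sub_const_cobounded c)).eventually_ge_atTop 1] with z hz
  rw [Real.posLog_eq_log (x := ‖z - c‖) (by rwa [abs_norm])]
  ring

theorem exists_green_sub_log_norm_isBigO {p : ℂ[X]} (hp : 2 ≤ p.natDegree) :
    ∃ (c : ℂ) (L : ℝ), (fun z => green p z - L - Real.log ‖z - c‖) =O[cobounded ℂ]
      fun z => (‖z‖ ^ 2)⁻¹ := by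
  obtain ⟨c, hc⟩ := exists_log_norm_eval_sub_isBigO hp
  obtain ⟨R, hR⟩ := exists_isEscapeRadius hp
  have hd : (2 : ℝ) ≤ p.natDegree := by exact_mod_cast hp
  refine ⟨c, Real.log ‖p.leadingCoeff‖ / (p.natDegree - 1), ?_⟩
  refine hR.isBigO_of_map_sub_isBigO hd ?_ (fun z hz => ?_) (hc.neg_left.congr_left fun z => ?_)
  · refine ((green_sub_log_norm_sub_isBigO_one hp c).sub
      (isBigO_const_const (Real.log ‖p.leadingCoeff‖ / (p.natDegree - 1)) one_ne_zero _)).congr_left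
      fun z => by ring
  · have hpos : 0 < ‖z‖ := (one_pos.trans_le hR.one_le).trans hz
    have := hR.two_mul_norm_le z hz
    simp only [norm_inv, norm_pow, norm_norm]
    gcongr
    linarith
  · have hd1 : (p.natDegree : ℝ) - 1 ≠ 0 := by linarith
    rw [green_eval hp]
    field_simp
    ring

theorem exp_two_mul_sub_norm_sub_sq_isBigO_one {E : Type*} [NormedAddCommGroup E] {F : E → ℝ}
    {c : E} (h : (fun z => F z - Real.log ‖z - c‖) =O[cobounded E] fun z => (‖z‖ ^ 2)⁻¹) :
    (fun z => Real.exp (2 * F z) - ‖z - c‖ ^ 2) =O[cobounded E] (1 : E → ℝ) := by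
  have hexp : (fun x => Real.exp (2 * x) - 1) =O[𝓝 0] fun x => x := by
    have hd : DifferentiableAt ℝ (fun x => Real.exp (2 * x)) 0 := by fun_prop
    simpa using hd.isBigO_sub
  have hratio := (hexp.comp_tendsto (h.trans_tendsto tendsto_inv_norm_sq_cobounded)).trans h
  have hsq : (fun z : E => ‖z - c‖ ^ 2) =O[cobounded E] fun z => ‖z‖ ^ 2 :=
    (id_isTheta_sub_const_cobounded c).2.norm_norm.pow 2
  refine (hsq.mul hratio).congr' ?_ ?_
  · filter_upwards [eventually_ne_cobounded c] with z hz
    have hpos : 0 < ‖z - c‖ := norm_pos_iff.2 (sub_ne_zero.2 hz)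
    rw [Function.comp_apply, mul_sub, mul_sub, Real.exp_sub, two_mul (Real.log _), Real.exp_add,
      Real.exp_log hpos]
    field_simp
  · filter_upwards [eventually_ne_cobounded 0] with z hz
    exact mul_inv_cancel₀ (pow_ne_zero 2 (norm_ne_zero_iff.2 hz))

theorem tendsto_eval_div_pow_natDegree_cobounded (p : ℂ[X]) :
    Tendsto (fun z => p.eval z / z ^ p.natDegree) (cobounded ℂ) (𝓝 p.leadingCoeff) := by
  have h := (isEquivalent_cobounded_leading_monomial (P := p)).div
    (IsEquivalent.refl (u := fun z : ℂ => z ^ p.natDegree))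
  refine (h.congr_right ?_).tendsto_const
  filter_upwards [eventually_ne_cobounded 0] with z hz
  exact mul_div_cancel_right₀ _ (pow_ne_zero _ hz)

theorem tendsto_ofReal_mul_cobounded {ω : ℂ} (hω : ω ≠ 0) :
    Tendsto (fun t : ℝ => (t * ω : ℂ)) atTop (cobounded ℂ) := by
  rw [← tendsto_norm_atTop_iff_cobounded]
  simp only [norm_mul, Complex.norm_real]
  exact tendsto_norm_atTop_atTop.atTop_mul_const (norm_pos_iff.2 hω)

/-- Writing `f ~ A z ^ m` and `g ~ B z ^ n`, the direction `ω` makes `A * conj B * ω ^ (m - n)`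
positive. -/
theorem exists_tendsto_re_eval_mul_conj_atTop {f g : ℂ[X]} (hg : g ≠ 0)
    (hgf : g.natDegree < f.natDegree) :
    ∃ ω : ℂ, ω ≠ 0 ∧
      Tendsto (fun t : ℝ => (f.eval (t * ω) * conj (g.eval (t * ω))).re) atTop atTop := by
  have hf : f ≠ 0 := ne_zero_of_natDegree_gt hgf
  set m := f.natDegree
  set n := g.natDegree
  set A := f.leadingCoeff * conj g.leadingCoeff
  have hA : A ≠ 0 := mul_ne_zero (leadingCoeff_ne_zero.2 hf)
    (star_ne_zero.2 (leadingCoeff_ne_zero.2 hg))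
  obtain ⟨ω, hω⟩ := IsAlgClosed.exists_pow_nat_eq (conj A) (Nat.sub_pos_of_lt hgf)
  have hω0 : ω ≠ 0 := by
    rintro rfl
    rw [zero_pow (Nat.sub_ne_zero_of_lt hgf)] at hω
    exact star_ne_zero.2 hA hω.symm
  refine ⟨ω, hω0, ?_⟩
  have hray := tendsto_ofReal_mul_cobounded hω0
  have hlimit : A * (ω ^ m * conj ω ^ n) = (‖A‖ ^ 2 * ‖ω‖ ^ (2 * n) : ℝ) := by
    rw [← Nat.sub_add_cancel hgf.le, pow_add, hω, mul_assoc (conj A), ← mul_pow, ← mul_assoc,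
      Complex.mul_conj', Complex.mul_conj']
    push_cast
    ring
  have hprod := ((tendsto_eval_div_pow_natDegree_cobounded f).comp hray).mul
    ((Complex.continuous_conj.tendsto _).comp
      ((tendsto_eval_div_pow_natDegree_cobounded g).comp hray))
    |>.mul_const (ω ^ m * conj ω ^ n)
  rw [hlimit] at hprod
  have hre := (Complex.continuous_re.tendsto _).comp hprod
  rw [Complex.ofReal_re] at hre
  refine ((tendsto_pow_atTop (α := ℝ) (n := m + n) (by omega)).atTop_mul_pos (by positivity)
    hre).congr' ?_
  filter_upwards [eventually_ne_atTop 0] with t ht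
  have ht' : (t : ℂ) ≠ 0 := Complex.ofReal_ne_zero.2 ht
  have hω' : conj ω ≠ 0 := star_ne_zero.2 hω0
  rw [Function.comp_apply, ← Complex.re_ofReal_mul]
  congr 1
  simp only [Function.comp_apply, map_div₀, map_mul, map_pow, Complex.conj_ofReal]
  push_cast
  field_simp
  ring

theorem norm_leadingCoeff_eq_of_norm_sq_sub_isBigO_one {f g : ℂ[X]}
    (hdeg : f.natDegree = g.natDegree) (hg : 0 < g.natDegree)
    (h : (fun z => ‖f.eval z‖ ^ 2 - ‖g.eval z‖ ^ 2) =O[cobounded ℂ] (1 : ℂ → ℝ)) :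
    ‖f.leadingCoeff‖ = ‖g.leadingCoeff‖ := by
  have hpow : Tendsto (fun z : ℂ => (‖z‖ ^ (g.natDegree * 2))⁻¹) (cobounded ℂ) (𝓝 0) :=
    ((tendsto_pow_atTop (by omega)).comp tendsto_norm_cobounded_atTop).inv_tendsto_atTop
  have hzero := (h.mul (isBigO_refl (fun z : ℂ => (‖z‖ ^ (g.natDegree * 2))⁻¹) _)).trans_tendsto
    (by simpa using hpow)
  have hsub := ((tendsto_eval_div_pow_natDegree_cobounded f).norm.pow 2).sub
    ((tendsto_eval_div_pow_natDegree_cobounded g).norm.pow 2)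
  have hsq := tendsto_nhds_unique (hsub.congr fun z => ?_) hzero
  · exact (sq_eq_sq₀ (norm_nonneg _) (norm_nonneg _)).1 (sub_eq_zero.1 hsq)
  · rw [hdeg, norm_div, norm_div, norm_pow, div_pow, div_pow, ← pow_mul, ← sub_div, div_eq_mul_inv]

theorem exists_eq_C_mul_of_norm_sq_sub_isBigO_one {f g : ℂ[X]} (hdeg : f.natDegree = g.natDegree)
    (hg : 0 < g.natDegree)
    (h : (fun z => ‖f.eval z‖ ^ 2 - ‖g.eval z‖ ^ 2) =O[cobounded ℂ] (1 : ℂ → ℝ)) :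
    ∃ γ : ℂ, ‖γ‖ = 1 ∧ f = C γ * g := by
  have hf0 : f ≠ 0 := ne_zero_of_natDegree_gt (hdeg ▸ hg)
  have hlead : g.leadingCoeff ≠ 0 := leadingCoeff_ne_zero.2 (ne_zero_of_natDegree_gt hg)
  set γ := f.leadingCoeff / g.leadingCoeff
  have hγ : ‖γ‖ = 1 := by
    rw [norm_div, norm_leadingCoeff_eq_of_norm_sq_sub_isBigO_one hdeg hg h,
      div_self (norm_ne_zero_iff.2 hlead)]
  have hdegγ : (C γ * g).natDegree = f.natDegree := by
    rw [natDegree_C_mul (norm_ne_zero_iff.1 (hγ ▸ one_ne_zero)), hdeg]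
  have hγg : C γ * g ≠ 0 := ne_zero_of_natDegree_gt (hdegγ ▸ hdeg ▸ hg)
  refine ⟨γ, hγ, sub_eq_zero.1 ?_⟩
  by_contra hr
  have hrdeg : (f - C γ * g).natDegree < (C γ * g).natDegree := by
    refine natDegree_lt_natDegree hr (degree_sub_lt_right ?_ hγg ?_)
    · rw [degree_eq_natDegree hf0, degree_eq_natDegree hγg, hdegγ]
    · rw [leadingCoeff_mul, leadingCoeff_C, div_mul_cancel₀ _ hlead]
  obtain ⟨ω, hω, hlim⟩ := exists_tendsto_re_eval_mul_conj_atTop hr hrdeg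
  obtain ⟨B, hB⟩ := h.bound
  obtain ⟨t, htB, ht⟩ := ((tendsto_ofReal_mul_cobounded hω).eventually hB |>.and
    (hlim.eventually_gt_atTop (B / 2))).exists
  have hexpand := Complex.normSq_add ((C γ * g).eval (t * ω)) ((f - C γ * g).eval (t * ω))
  rw [← eval_add, add_sub_cancel, eval_mul, eval_C, Complex.normSq_mul] at hexpand
  simp only [Complex.normSq_eq_norm_sq, hγ, one_pow, one_mul] at hexpand
  rw [eval_mul, eval_C] at ht
  rw [Pi.one_apply, norm_one, mul_one, Real.norm_eq_abs] at htB
  linarith [le_abs_self (‖f.eval (t * ω)‖ ^ 2 - ‖g.eval (t * ω)‖ ^ 2),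
    sq_nonneg ‖(f - C γ * g).eval (t * ω)‖]

theorem tendsto_eval_cobounded {p : ℂ[X]} (hp : 0 < p.natDegree) :
    Tendsto (p.eval ·) (cobounded ℂ) (cobounded ℂ) :=
  tendsto_norm_atTop_iff_cobounded.1
    (p.tendsto_norm_atTop (natDegree_pos_iff_degree_pos.1 hp) tendsto_norm_cobounded_atTop)

/-- Both compositions multiply the common Green function by the product of the degrees, so their
distances to the centre `c` of the Green function agree up to a bounded error. -/
theorem exists_comp_eq_C_mul_comp_add_C {p q : ℂ[X]} (hp : 2 ≤ p.natDegree) (hq : 2 ≤ q.natDegree)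
    (h : filledJuliaSet (p.eval ·) = filledJuliaSet (q.eval ·)) :
    ∃ a b : ℂ, ‖a‖ = 1 ∧ p.comp q = C a * q.comp p + C b := by
  obtain ⟨c, L, hcL⟩ := exists_green_sub_log_norm_isBigO hp
  have hc : ∀ f : ℂ[X], 0 < f.natDegree →
      (fun z => Real.exp (2 * (green p (f.eval z) - L)) - ‖f.eval z - c‖ ^ 2)
        =O[cobounded ℂ] (1 : ℂ → ℝ) := fun f hf =>
    (exp_two_mul_sub_norm_sub_sq_isBigO_one hcL).comp_tendsto (tendsto_eval_cobounded hf)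
  have hpq : green q = green p := funext fun z =>
    le_antisymm (green_le_green_of_filledJuliaSet_subset hp hq h.le z)
      (green_le_green_of_filledJuliaSet_subset hq hp h.ge z)
  have hgreen : ∀ z, green p (p.eval (q.eval z)) = green p (q.eval (p.eval z)) := fun z => by
    rw [green_eval hp, ← hpq, green_eval hq, green_eval hq, hpq, green_eval hp]
    ring
  have hdeg : (p.comp q).natDegree = (q.comp p).natDegree := by
    rw [natDegree_comp, natDegree_comp, mul_comm]
  have hpos : 0 < (q.comp p).natDegree := by rw [natDegree_comp]; positivity
  have hbdd : (fun z => ‖(p.comp q - C c).eval z‖ ^ 2 - ‖(q.comp p - C c).eval z‖ ^ 2)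
      =O[cobounded ℂ] (1 : ℂ → ℝ) := by
    refine ((hc _ hpos).sub (hc _ (hdeg ▸ hpos))).congr_left fun z => ?_
    simp only [eval_sub, eval_comp, eval_C, hgreen]
    ring
  obtain ⟨γ, hγ, heq⟩ := exists_eq_C_mul_of_norm_sq_sub_isBigO_one
    (by rwa [natDegree_sub_C, natDegree_sub_C]) (by rwa [natDegree_sub_C]) hbdd
  refine ⟨γ, c - γ * c, hγ, ?_⟩
  rw [← sub_add_cancel (p.comp q) (C c), heq, C_sub, C_mul]
  ring

end GreenAtInfinity

section NormalFamilies

theorem isClosed_juliaSet {E : Type*} [UniformSpace E] (f : E → E) : IsClosed (juliaSet f) := by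
  rw [juliaSet, isClosed_compl_iff, isOpen_iff_forall_mem_open]
  rintro x ⟨U, hU, hx, hN⟩
  exact ⟨U, fun y hy => ⟨U, hU, hy, hN⟩, hU, hx⟩

theorem isNormalFamilyOn_of_eventually_notMem {E : Type*} [UniformSpace E] {F : ℕ → E → E}
    {U : Set E} (h : ∀ K ⊆ U, IsCompact K → ∀ C : Set E, IsCompact C →
      ∀ᶠ n in atTop, ∀ x ∈ K, F n x ∉ C) :
    IsNormalFamilyOn F U := by
  intro s
  by_cases hs : ∃ n, ∃ᶠ k in atTop, s k = n
  · obtain ⟨n, hn⟩ := hs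
    obtain ⟨φ, hφ, hφn⟩ := extraction_of_frequently_atTop hn
    refine ⟨φ, hφ, Or.inl ⟨F n, fun K _ _ u hu => ?_⟩⟩
    exact Eventually.of_forall fun k x _ => by simpa only [hφn] using refl_mem_uniformity hu
  · simp only [not_exists, not_frequently] at hs
    have hs' : Tendsto s atTop atTop :=
      (le_cofinite_iff_eventually_ne.2 hs).trans_eq Nat.cofinite_eq_atTop
    exact ⟨id, strictMono_id, Or.inr fun K hKU hK C hC => hs'.eventually (h K hKU hK C hC)⟩

theorem exists_subseq_tendstoUniformlyOn_of_lipschitzOnWith {α β : Type*} [PseudoMetricSpace α]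
    [MetricSpace β] {K : Set α} (hK : IsCompact K) {L : Set β} (hL : IsCompact L) {C : NNReal}
    {F : ℕ → α → β} (hF : ∀ n, LipschitzOnWith C (F n) K) (hmaps : ∀ n, Set.MapsTo (F n) K L) :
    ∃ φ : ℕ → ℕ, StrictMono φ ∧ ∃ g : α → β, TendstoUniformlyOn (fun k => F (φ k)) g atTop K := by
  classical
  have : CompactSpace K := isCompact_iff_compactSpace.1 hK
  let f : ℕ → BoundedContinuousFunction K β := fun n =>
    .mkOfCompact ⟨K.domRestrict (F n), (hF n).continuousOn.domRestrict⟩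
  have hequi : Equicontinuous ((↑) : Set.range f → K → β) := by
    refine Metric.equicontinuous_of_continuity_modulus (fun t => C * t) ?_ _ ?_
    · exact Continuous.tendsto' (by fun_prop) _ _ (mul_zero _)
    · rintro x y ⟨_, n, rfl⟩
      exact (hF n).dist_le_mul x x.2 y y.2
  have hcpt : IsCompact (closure (Set.range f)) :=
    BoundedContinuousFunction.arzela_ascoli L hL _
      (by rintro _ x ⟨n, rfl⟩; exact hmaps n x.2) hequi
  obtain ⟨g, -, φ, hφ, hg⟩ := hcpt.tendsto_subseq (x := f) fun n => subset_closure ⟨n, rfl⟩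
  refine ⟨φ, hφ, fun x => if h : x ∈ K then g ⟨x, h⟩ else F 0 x, ?_⟩
  rw [tendstoUniformlyOn_iff_tendstoUniformly_comp_coe]
  convert BoundedContinuousFunction.tendsto_iff_tendstoUniformly.1 hg using 1
  · rfl
  · ext x
    simp

variable {E F : Type*} [NormedAddCommGroup E] [NormedSpace ℂ E] [NormedAddCommGroup F]
  [NormedSpace ℂ F] {c : E} {r B : ℝ}

theorem dist_le_div_mul_dist_of_norm_le {f : E → F} (hr : 0 < r)
    (hd : DifferentiableOn ℂ f (Metric.ball c (2 * r)))
    (hB : ∀ x ∈ Metric.ball c (2 * r), ‖f x‖ ≤ B) {x y : E} (hx : x ∈ Metric.closedBall c r)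
    (hy : y ∈ Metric.closedBall c r) : dist (f x) (f y) ≤ 2 * B / r * dist x y := by
  have hsub : Metric.ball y r ⊆ Metric.ball c (2 * r) :=
    Metric.ball_subset_ball' (by linarith [Metric.mem_closedBall.1 hy])
  have hle : Metric.closedBall c r ⊆ Metric.ball c (2 * r) :=
    Metric.closedBall_subset_ball (by linarith)
  have hdist : ∀ z ∈ Metric.ball c (2 * r), dist (f z) (f y) ≤ 2 * B := fun z hz => by
    linarith [dist_le_norm_add_norm (f z) (f y), hB z hz, hB y (hle hy)]
  rcases lt_or_ge (dist x y) r with hxy | hxy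
  · exact Complex.dist_le_div_mul_dist_of_mapsTo_ball (hd.mono hsub)
      (fun z hz => hdist z (hsub hz)) hxy
  · calc dist (f x) (f y) ≤ 2 * B := hdist x (hle hx)
      _ = 2 * B / r * r := by field_simp
      _ ≤ 2 * B / r * dist x y := by
        have : 0 ≤ B := (norm_nonneg _).trans (hB y (hle hy))
        gcongr

theorem isNormalFamilyOn_ball_of_norm_le [ProperSpace E] {ι : Type*} {f : ι → E → E} (hr : 0 < r)
    (hd : ∀ i, DifferentiableOn ℂ (f i) (Metric.ball c (2 * r)))
    (hB : ∀ i, ∀ x ∈ Metric.ball c (2 * r), ‖f i x‖ ≤ B) :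
    IsNormalFamilyOn f (Metric.ball c r) := by
  intro s
  obtain ⟨φ, hφ, g, hg⟩ := exists_subseq_tendstoUniformlyOn_of_lipschitzOnWith
    (isCompact_closedBall c r) (isCompact_closedBall (0 : E) B) (C := (2 * B / r).toNNReal)
    (F := fun n => f (s n))
    (fun n => .of_dist_le_mul fun x hx y hy =>
      (dist_le_div_mul_dist_of_norm_le hr (hd _) (hB _) hx hy).trans <| by
        gcongr; exact Real.le_coe_toNNReal _)
    (fun n x hx => mem_closedBall_zero_iff.2 <|
      hB _ x (Metric.closedBall_subset_ball (by linarith) hx))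
  exact ⟨φ, hφ, Or.inl ⟨g, fun K hK _ => hg.mono (hK.trans Metric.ball_subset_closedBall)⟩⟩

end NormalFamilies

section EigenPairs

open scoped Matrix

/-- `a` and `b` are the two eigenvalues of the `2 × 2` matrix `M`, with multiplicity: this is
encoded by the factorisation `(X - a) * (X - b)` of its characteristic polynomial. -/
structure IsEigenPair {R : Type*} [CommRing R] (M : Matrix (Fin 2) (Fin 2) R) (a b : R) :
    Prop where
  trace_eq : M.trace = a + b
  det_eq : M.det = a * b

theorem det_sub_smul_one {R : Type*} [CommRing R] (M : Matrix (Fin 2) (Fin 2) R) (c : R) :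
    (M - c • 1).det = c ^ 2 - c * M.trace + M.det := by
  simp only [Matrix.det_fin_two, Matrix.trace_fin_two, Matrix.sub_apply, Matrix.smul_apply,
    Matrix.one_apply_eq, Matrix.one_apply_ne zero_ne_one, Matrix.one_apply_ne one_ne_zero,
    smul_eq_mul]
  ring

theorem sub_mul_eval_divByMonic {R : Type*} [CommRing R] (f : R[X]) (a b : R) :
    (b - a) * (f /ₘ (X - C a)).eval b = f.eval b - f.eval a := by
  conv_rhs => rw [← modByMonic_add_div f (X - C a), modByMonic_X_sub_C_eq_C_eval]
  simp

theorem aeval_eq_add_sub_smul_one_mul {R A : Type*} [CommRing R] [Ring A] [Algebra R A] (f : R[X])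
    (x : A) (c : R) :
    aeval x f = f.eval c • 1 + (x - c • 1) * aeval x (f /ₘ (X - C c)) := by
  conv_lhs => rw [← modByMonic_add_div f (X - C c), modByMonic_X_sub_C_eq_C_eval]
  simp [Algebra.algebraMap_eq_smul_one]

namespace IsEigenPair

section CommRing

variable {R : Type*} [CommRing R] {M : Matrix (Fin 2) (Fin 2) R} {a b : R}

theorem of_trace_eq_of_det_eq_zero (htr : M.trace = a + b) (hdet : (M - a • 1).det = 0) :
    IsEigenPair M a b := by
  rw [det_sub_smul_one] at hdet
  exact ⟨htr, by linear_combination hdet + a * htr⟩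

theorem symm (h : IsEigenPair M a b) : IsEigenPair M b a :=
  ⟨h.trace_eq.trans (add_comm _ _), h.det_eq.trans (mul_comm _ _)⟩

theorem det_sub_smul_one_eq (h : IsEigenPair M a b) (c : R) :
    (M - c • 1).det = (c - a) * (c - b) := by
  rw [det_sub_smul_one, h.trace_eq, h.det_eq]; ring

theorem smul_one (c : R) : IsEigenPair (c • 1) c c := by
  constructor
  · simp [mul_two]
  · simp [sq]

theorem sub_mul_sub (h : IsEigenPair M a b) : (M - a • 1) * (M - b • 1) = 0 := by
  nontriviality R
  have hfactor : M.charpoly = (X - C a) * (X - C b) := by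
    rw [Matrix.charpoly_fin_two, h.trace_eq, h.det_eq, C_add, C_mul]; ring
  simpa only [hfactor, map_mul, map_sub, aeval_X, aeval_C, Algebra.algebraMap_eq_smul_one]
    using M.aeval_self_charpoly

theorem aeval_eq (h : IsEigenPair M a b) (f : R[X]) :
    aeval M f = f.eval a • (1 : Matrix (Fin 2) (Fin 2) R)
      + (f /ₘ (X - C a)).eval b • (M - a • 1) := by
  rw [aeval_eq_add_sub_smul_one_mul f M a, aeval_eq_add_sub_smul_one_mul (f /ₘ (X - C a)) M b,
    mul_add, ← mul_assoc, h.sub_mul_sub, zero_mul, add_zero, mul_smul_comm, mul_one]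

theorem smul_one_add_smul_sub (h : IsEigenPair M a b) (u s : R) :
    IsEigenPair (u • 1 + s • (M - a • 1)) u (u + s * (b - a)) := by
  obtain ⟨htr, hdet⟩ := h
  rw [Matrix.trace_fin_two] at htr
  rw [Matrix.det_fin_two] at hdet
  constructor
  · simp [Matrix.trace_fin_two]
    linear_combination s * htr
  · simp [Matrix.det_fin_two]
    linear_combination s ^ 2 * (hdet - a * htr) + u * s * htr

theorem add_smul_one (h : IsEigenPair M a b) (t : R) : IsEigenPair (M + t • 1) (a + t) (b + t) := by
  convert h.smul_one_add_smul_sub (a + t) 1 using 1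
  · module
  · ring

protected theorem aeval (h : IsEigenPair M a b) (f : R[X]) :
    IsEigenPair (aeval M f) (f.eval a) (f.eval b) := by
  convert h.smul_one_add_smul_sub (f.eval a) ((f /ₘ (X - C a)).eval b) using 1
  · exact h.aeval_eq f
  · linear_combination -sub_mul_eval_divByMonic f a b

end CommRing

theorem exists_perturbation {K : Type*} [Field K] {M : Matrix (Fin 2) (Fin 2) K} {a b : K}
    (h : IsEigenPair M a b) :
    ∃ D : Matrix (Fin 2) (Fin 2) K, ∀ t : K, IsEigenPair (M + t • D) a (b + t) := by
  obtain ⟨v, hv, hMv⟩ := Matrix.exists_mulVec_eq_zero_iff.2 <|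
    show (M - a • 1).det = 0 by rw [h.det_sub_smul_one_eq, sub_self, zero_mul]
  obtain ⟨u, hu⟩ : ∃ u : Fin 2 → K, u ⬝ᵥ ![v 1, -v 0] = 1 := by
    by_cases hv0 : v 0 = 0
    · have hv1 : v 1 ≠ 0 := fun hv1 => hv (by ext i; fin_cases i <;> assumption)
      exact ⟨![(v 1)⁻¹, 0], by simp [hv1]⟩
    · exact ⟨![0, -(v 0)⁻¹], by simp [hv0]⟩
  -- `vecMulVec u ![v 1, -v 0]` has trace `1` and kills the eigenvector `v`.
  refine ⟨Matrix.vecMulVec u ![v 1, -v 0], fun t =>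
    of_trace_eq_of_det_eq_zero ?_ (Matrix.exists_mulVec_eq_zero_iff.1 ⟨v, hv, ?_⟩)⟩
  · rw [Matrix.trace_add, h.trace_eq, Matrix.trace_smul, Matrix.trace_vecMulVec, hu, smul_eq_mul,
      mul_one, add_assoc]
  · have hvv : ![v 1, -v 0] ⬝ᵥ v = 0 := by
      simp [dotProduct, Fin.sum_univ_two, mul_comm]
    rw [add_sub_right_comm, Matrix.add_mulVec, hMv, zero_add, Matrix.smul_mulVec,
      Matrix.vecMulVec_mulVec, hvv]
    simp

end IsEigenPair

theorem exists_isEigenPair {K : Type*} [Field K] [IsAlgClosed K] (M : Matrix (Fin 2) (Fin 2) K) :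
    ∃ a b, IsEigenPair M a b := by
  have hcard : M.charpoly.roots.card = 2 := by
    rw [← (IsAlgClosed.splits M.charpoly).natDegree_eq_card_roots, M.charpoly_natDegree_eq_dim,
      Fintype.card_fin]
  obtain ⟨a, b, hab⟩ := Multiset.card_eq_two.1 hcard
  exact ⟨a, b, by simp [Matrix.trace_eq_sum_roots_charpoly, hab],
    by simp [Matrix.det_eq_prod_roots_charpoly, hab]⟩

end EigenPairs

section DividedDifference

variable {f : ℂ[X]} {a b : ℂ} {B δ : ℝ}

theorem norm_eval_divByMonic_le (hδ : 0 < δ) (hab : δ ≤ ‖b - a‖) (ha : ‖f.eval a‖ ≤ B)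
    (hb : ‖f.eval b‖ ≤ B) : ‖(f /ₘ (X - C a)).eval b‖ ≤ 2 * B / δ := by
  rw [le_div_iff₀ hδ]
  calc ‖(f /ₘ (X - C a)).eval b‖ * δ ≤ ‖(f /ₘ (X - C a)).eval b‖ * ‖b - a‖ := by gcongr
    _ = ‖f.eval b - f.eval a‖ := by rw [← sub_mul_eval_divByMonic, norm_mul, mul_comm]
    _ ≤ ‖f.eval b‖ + ‖f.eval a‖ := norm_sub_le _ _
    _ ≤ 2 * B := by linarith

theorem norm_eval_divByMonic_le_of_closedBall (hδ : 0 < δ)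
    (ha : ∀ z ∈ Metric.closedBall a δ, ‖f.eval z‖ ≤ B) (hb : ‖f.eval b‖ ≤ B) :
    ‖(f /ₘ (X - C a)).eval b‖ ≤ 2 * B / δ := by
  have haa := ha a (Metric.mem_closedBall_self hδ.le)
  rcases le_or_gt δ ‖b - a‖ with hab | hab
  · exact norm_eval_divByMonic_le hδ hab haa hb
  · refine Complex.norm_le_of_forall_mem_frontier_norm_le (U := Metric.ball a δ)
      Metric.isBounded_ball (f /ₘ (X - C a)).differentiable.diffContOnCl (fun z hz => ?_)
      (subset_closure (mem_ball_iff_norm.2 hab))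
    rw [frontier_ball _ hδ.ne'] at hz
    exact norm_eval_divByMonic_le hδ (mem_sphere_iff_norm.1 hz).ge haa
      (ha z (Metric.sphere_subset_closedBall hz))

end DividedDifference

section MatrixNorm

attribute [local instance] Matrix.normedAddCommGroup Matrix.normedSpace

theorem differentiable_aeval_matrix {n : Type*} [Fintype n] [DecidableEq n] (f : ℂ[X]) :
    Differentiable ℂ fun M : Matrix n n ℂ => aeval M f := by
  have hentry : ∀ i j, Differentiable ℂ fun M : Matrix n n ℂ => M i j := fun i j => by fun_prop
  have hpow : ∀ k i j, Differentiable ℂ fun M : Matrix n n ℂ => (M ^ k) i j := by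
    intro k
    induction k with
    | zero => exact fun i j => by simp only [pow_zero]; fun_prop
    | succ k ih =>
      intro i j
      simp only [pow_succ, Matrix.mul_apply]
      exact Differentiable.fun_sum fun l _ => (ih i l).mul (hentry l j)
  refine differentiable_pi.2 fun i => differentiable_pi.2 fun j => ?_
  simp only [aeval_eq_sum_range, Matrix.sum_apply, Matrix.smul_apply]
  exact Differentiable.fun_sum fun k _ => (hpow k i j).const_smul (f.coeff k)

namespace IsEigenPair

variable {M : Matrix (Fin 2) (Fin 2) ℂ} {a b : ℂ}

theorem norm_le (h : IsEigenPair M a b) : ‖a‖ ≤ ‖M.trace‖ + ‖M.det‖ + 1 := by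
  rcases le_or_gt ‖a‖ 1 with h1 | h1
  · linarith [norm_nonneg M.trace, norm_nonneg M.det]
  · have heq : a ^ 2 = M.trace * a - M.det := by rw [h.trace_eq, h.det_eq]; ring
    have hle : ‖a‖ ^ 2 ≤ ‖M.trace‖ * ‖a‖ + ‖M.det‖ := by
      rw [← norm_pow, heq, ← norm_mul]; exact norm_sub_le _ _
    nlinarith [norm_nonneg M.trace, norm_nonneg M.det]

theorem eventually_dist_lt (h : IsEigenPair M a b) {ε : ℝ} (hε : 0 < ε) :
    ∀ᶠ N in 𝓝 M, ∀ c d, IsEigenPair N c d →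
      (dist c a < ε ∧ dist d b < ε) ∨ (dist d a < ε ∧ dist c b < ε) := by
  have hdet : ∀ᶠ N in 𝓝 M, ‖(N - a • 1).det‖ < ε / 2 * (ε / 2) := by
    have hcont : Continuous fun N : Matrix (Fin 2) (Fin 2) ℂ => ‖(N - a • 1).det‖ := by fun_prop
    exact hcont.continuousAt.eventually_lt continuousAt_const (by
      rw [h.det_sub_smul_one_eq, sub_self, zero_mul, norm_zero]; positivity)
  have htrace : ∀ᶠ N in 𝓝 M, ‖N.trace - M.trace‖ < ε / 2 := by
    have hcont : Continuous fun N : Matrix (Fin 2) (Fin 2) ℂ => ‖N.trace - M.trace‖ := by fun_prop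
    exact hcont.continuousAt.eventually_lt continuousAt_const (by simpa using hε)
  filter_upwards [hdet, htrace] with N hdet htrace
  have hmatch : ∀ c d, IsEigenPair N c d → dist c a < ε / 2 → dist c a < ε ∧ dist d b < ε := by
    intro c d hcd hca
    have heq : d - b = (N.trace - M.trace) - (c - a) := by rw [hcd.trace_eq, h.trace_eq]; ring
    rw [dist_eq_norm] at hca
    simp only [dist_eq_norm, heq]
    exact ⟨by linarith, (norm_sub_le _ _).trans_lt (by linarith)⟩
  intro c d hcd
  rcases lt_or_ge (dist c a) (ε / 2) with hc | hc
  · exact Or.inl (hmatch c d hcd hc)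
  · refine Or.inr (hmatch d c hcd.symm ?_)
    by_contra! hd
    rw [hcd.det_sub_smul_one_eq, norm_mul, ← dist_eq_norm, ← dist_eq_norm, dist_comm a,
      dist_comm a] at hdet
    exact hdet.not_ge (by gcongr)

theorem norm_aeval_le (h : IsEigenPair M a b) (f : ℂ[X]) :
    ‖aeval M f‖ ≤ ‖f.eval a‖ * ‖(1 : Matrix (Fin 2) (Fin 2) ℂ)‖ +
      ‖(f /ₘ (X - C a)).eval b‖ * ‖M - a • 1‖ := by
  rw [h.aeval_eq f, ← norm_smul, ← norm_smul]
  exact norm_add_le _ _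

end IsEigenPair

theorem exists_norm_le_of_isEigenPair {S : Set (Matrix (Fin 2) (Fin 2) ℂ)} (hS : IsCompact S) :
    ∃ B : ℝ, ∀ M ∈ S, ∀ a b, IsEigenPair M a b → ‖a‖ ≤ B := by
  have hcont : Continuous fun M : Matrix (Fin 2) (Fin 2) ℂ => ‖M.trace‖ + ‖M.det‖ + 1 := by
    fun_prop
  obtain ⟨B, hB⟩ := hS.bddAbove_image hcont.continuousOn
  exact ⟨B, fun M hM a b hab => hab.norm_le.trans (hB ⟨M, hM, rfl⟩)⟩

end MatrixNorm

section MatrixPoly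

theorem matrixPoly_eq_aeval (p : ℂ[X]) (M : Matrix (Fin 2) (Fin 2) ℂ) :
    matrixPoly p M = aeval M p := by
  rw [aeval_eq_sum_range, matrixPoly]

theorem matrixPoly_iterate (p : ℂ[X]) (n : ℕ) (M : Matrix (Fin 2) (Fin 2) ℂ) :
    (matrixPoly p)^[n] M = aeval M (p.comp^[n] X) := by
  induction n with
  | zero => simp
  | succ n ih =>
    rw [Function.iterate_succ_apply', ih, matrixPoly_eq_aeval, ← aeval_comp,
      Function.iterate_succ_apply']

theorem matrixPoly_smul_one (p : ℂ[X]) (c : ℂ) : matrixPoly p (c • 1) = p.eval c • 1 := by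
  rw [matrixPoly_eq_aeval, ← Algebra.algebraMap_eq_smul_one, ← Algebra.algebraMap_eq_smul_one,
    aeval_algebraMap_apply_eq_algebraMap_eval]

theorem commute_eval_of_commute_matrixPoly {p q : ℂ[X]}
    (h : Function.Commute (matrixPoly p) (matrixPoly q)) :
    Function.Commute (p.eval ·) (q.eval ·) := fun z => by
  have hz := congrFun (congrFun (h (z • 1)) 0) 0
  simpa only [matrixPoly_smul_one, Matrix.smul_apply, Matrix.one_apply_eq, smul_eq_mul,
    mul_one] using hz

attribute [local instance] Matrix.normedAddCommGroup Matrix.normedSpace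

theorem differentiable_matrixPoly (p : ℂ[X]) : Differentiable ℂ (matrixPoly p) := by
  simpa only [← matrixPoly_eq_aeval] using differentiable_aeval_matrix (n := Fin 2) p

variable {p : ℂ[X]} {M : Matrix (Fin 2) (Fin 2) ℂ} {a b : ℂ}

theorem IsEigenPair.iterate (h : IsEigenPair M a b) (n : ℕ) :
    IsEigenPair ((matrixPoly p)^[n] M) ((p.eval ·)^[n] a) ((p.eval ·)^[n] b) := by
  rw [matrixPoly_iterate, ← eval_iterate_comp_X, ← eval_iterate_comp_X]
  exact h.aeval _

theorem eventually_forall_iterate_matrixPoly_notMem (hp : 2 ≤ p.natDegree) {L : Set ℂ}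
    (hL : IsCompact L) (hd : Disjoint L (filledJuliaSet (p.eval ·)))
    {S : Set (Matrix (Fin 2) (Fin 2) ℂ)} (hS : IsCompact S) :
    ∀ᶠ n in atTop, ∀ N a b, IsEigenPair N a b → a ∈ L → (matrixPoly p)^[n] N ∉ S := by
  obtain ⟨B, hB⟩ := exists_norm_le_of_isEigenPair hS
  filter_upwards [eventually_forall_lt_norm_iterate_eval hp hL hd B] with n hn N a b hab ha hNS
  exact (hn a ha).not_ge (hB _ hNS _ _ (hab.iterate n))

theorem IsEigenPair.mem_fatouSet_of_notMem (hp : 2 ≤ p.natDegree) (h : IsEigenPair M a b)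
    (ha : a ∉ filledJuliaSet (p.eval ·)) : M ∈ fatouSet (matrixPoly p) := by
  obtain ⟨δ, hδ, hsub⟩ := Metric.nhds_basis_closedBall.mem_iff.1
    ((isClosed_filledJuliaSet_eval hp).isOpen_compl.mem_nhds ha)
  obtain ⟨U, hnear, hU, hMU⟩ := eventually_nhds_iff.1 (h.eventually_dist_lt hδ)
  refine ⟨U, hU, hMU, isNormalFamilyOn_of_eventually_notMem fun K hKU _ S hS => ?_⟩
  filter_upwards [(tendsto_add_atTop_nat 1).eventually
    (eventually_forall_iterate_matrixPoly_notMem hp (isCompact_closedBall a δ)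
      (Set.disjoint_left.2 fun z hz => hsub hz) hS)] with n hn N hN
  obtain ⟨c, d, hcd⟩ := exists_isEigenPair N
  rcases hnear N (hKU hN) c d hcd with hc | hd
  · exact hn N c d hcd (Metric.mem_closedBall.2 hc.1.le)
  · exact hn N d c hcd.symm (Metric.mem_closedBall.2 hd.1.le)

theorem IsEigenPair.norm_iterate_matrixPoly_le {R δ : ℝ} (hR : IsEscapeRadius (p.eval ·) R)
    (h : IsEigenPair M a b) (hδ : 0 < δ)
    (ha : Metric.closedBall a δ ⊆ filledJuliaSet (p.eval ·)) (hb : b ∈ filledJuliaSet (p.eval ·))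
    (n : ℕ) :
    ‖(matrixPoly p)^[n] M‖ ≤ R * ‖(1 : Matrix (Fin 2) (Fin 2) ℂ)‖ +
      2 * R / δ * (‖M‖ + R * ‖(1 : Matrix (Fin 2) (Fin 2) ℂ)‖) := by
  have hbound : ∀ z ∈ filledJuliaSet (p.eval ·), ‖(p.comp^[n] X).eval z‖ ≤ R := fun z hz => by
    rw [eval_iterate_comp_X]; exact hR.mem_filledJuliaSet_iff.1 hz n
  have haK := ha (Metric.mem_closedBall_self hδ.le)
  have hMa : ‖M - a • 1‖ ≤ ‖M‖ + R * ‖(1 : Matrix (Fin 2) (Fin 2) ℂ)‖ := by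
    refine (norm_sub_le _ _).trans ?_
    rw [norm_smul]
    gcongr
    exact hR.norm_le_of_mem_filledJuliaSet haK
  have hdiv := norm_eval_divByMonic_le_of_closedBall hδ (fun z hz => hbound z (ha hz)) (hbound b hb)
  have hR0 : 0 ≤ R := zero_le_one.trans hR.one_le
  rw [matrixPoly_iterate]
  refine (h.norm_aeval_le _).trans ?_
  gcongr
  exact hbound a haK

theorem IsEigenPair.exists_norm_iterate_le_of_mem_interior (hp : 2 ≤ p.natDegree)
    (h : IsEigenPair M a b) (ha : a ∈ interior (filledJuliaSet (p.eval ·)))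
    (hb : b ∈ interior (filledJuliaSet (p.eval ·))) :
    ∃ r > 0, ∃ B : ℝ, ∀ n, ∀ N ∈ Metric.ball M (2 * r), ‖(matrixPoly p)^[n] N‖ ≤ B := by
  obtain ⟨R, hR⟩ := exists_isEscapeRadius hp
  obtain ⟨δ, hδ, hsub⟩ := (Set.toFinite {a, b}).isCompact.exists_cthickening_subset_open
    isOpen_interior (Set.pair_subset ha hb)
  have hball : ∀ c, dist c a < δ / 2 ∨ dist c b < δ / 2 →
      Metric.closedBall c (δ / 2) ⊆ filledJuliaSet (p.eval ·) := by
    have hsub' : ∀ e ∈ ({a, b} : Set ℂ), ∀ c, dist c e < δ / 2 →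
        Metric.closedBall c (δ / 2) ⊆ filledJuliaSet (p.eval ·) := fun e he c hc =>
      (Metric.closedBall_subset_closedBall' (by linarith)).trans <|
        (Metric.closedBall_subset_cthickening he δ).trans <| hsub.trans interior_subset
    rintro c (hc | hc)
    exacts [hsub' a (by simp) c hc, hsub' b (by simp) c hc]
  obtain ⟨ρ, hρ, hnear⟩ :=
    Metric.eventually_nhds_iff_ball.1 (h.eventually_dist_lt (half_pos hδ))
  refine ⟨ρ / 2, half_pos hρ, R * ‖(1 : Matrix (Fin 2) (Fin 2) ℂ)‖ +
    2 * R / (δ / 2) * (‖M‖ + ρ + R * ‖(1 : Matrix (Fin 2) (Fin 2) ℂ)‖), fun n N hN => ?_⟩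
  rw [mul_div_cancel₀ ρ two_ne_zero] at hN
  obtain ⟨c, d, hcd⟩ := exists_isEigenPair N
  have hc : Metric.closedBall c (δ / 2) ⊆ filledJuliaSet (p.eval ·) :=
    hball c ((hnear N hN c d hcd).imp And.left And.right)
  have hd : d ∈ filledJuliaSet (p.eval ·) :=
    hball d ((hnear N hN c d hcd).symm.imp And.left And.right)
      (Metric.mem_closedBall_self (half_pos hδ).le)
  have hR0 : 0 ≤ R := zero_le_one.trans hR.one_le
  have hNM : ‖N‖ ≤ ‖M‖ + ρ := by
    linarith [norm_le_norm_add_norm_sub' N M, mem_ball_iff_norm.1 hN]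
  exact (hcd.norm_iterate_matrixPoly_le hR (half_pos hδ) hc hd n).trans (by gcongr)

theorem IsEigenPair.mem_fatouSet_of_mem_interior (hp : 2 ≤ p.natDegree) (h : IsEigenPair M a b)
    (ha : a ∈ interior (filledJuliaSet (p.eval ·)))
    (hb : b ∈ interior (filledJuliaSet (p.eval ·))) : M ∈ fatouSet (matrixPoly p) := by
  have : ProperSpace (Matrix (Fin 2) (Fin 2) ℂ) := FiniteDimensional.proper ℂ _
  obtain ⟨r, hr, B, hB⟩ := h.exists_norm_iterate_le_of_mem_interior hp ha hb
  exact ⟨Metric.ball M r, Metric.isOpen_ball, Metric.mem_ball_self hr,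
    isNormalFamilyOn_ball_of_norm_le hr
      (fun n => ((differentiable_matrixPoly p).iterate (n + 1)).differentiableOn)
      fun n => hB (n + 1)⟩

theorem IsEigenPair.mem_filledJuliaSet (hp : 2 ≤ p.natDegree) (h : IsEigenPair M a b) (hab : a ≠ b)
    (ha : a ∈ filledJuliaSet (p.eval ·)) (hb : b ∈ filledJuliaSet (p.eval ·)) :
    M ∈ filledJuliaSet (matrixPoly p) := by
  obtain ⟨R, hR⟩ := exists_isEscapeRadius hp
  refine mem_filledJuliaSet_of_norm_iterate_le (B := R * ‖(1 : Matrix (Fin 2) (Fin 2) ℂ)‖ +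
    2 * R / ‖b - a‖ * ‖M - a • 1‖) fun n => ?_
  have hbound : ∀ z ∈ filledJuliaSet (p.eval ·), ‖(p.comp^[n] X).eval z‖ ≤ R := fun z hz => by
    rw [eval_iterate_comp_X]; exact hR.mem_filledJuliaSet_iff.1 hz n
  have hdiv := norm_eval_divByMonic_le (norm_pos_iff.2 (sub_ne_zero.2 hab.symm)) le_rfl
    (hbound a ha) (hbound b hb)
  rw [matrixPoly_iterate]
  refine (h.norm_aeval_le _).trans ?_
  gcongr
  exact hbound a ha

theorem IsEigenPair.mem_juliaSet_of_mem_filledJuliaSet (hp : 2 ≤ p.natDegree)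
    (h : IsEigenPair M a b) (ha : a ∈ frontier (filledJuliaSet (p.eval ·)))
    (hM : M ∈ filledJuliaSet (matrixPoly p)) : M ∈ juliaSet (matrixPoly p) := by
  rintro ⟨U, hU, hMU, hN⟩
  have : ProperSpace (Matrix (Fin 2) (Fin 2) ℂ) := FiniteDimensional.proper ℂ _
  obtain ⟨t, htU, htK⟩ : ∃ t : ℂ, M + t • 1 ∈ U ∧ a + t ∉ filledJuliaSet (p.eval ·) := by
    have hcont : Continuous fun z : ℂ => M + (z - a) • (1 : Matrix (Fin 2) (Fin 2) ℂ) := by fun_prop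
    have hmem : ∀ᶠ z in 𝓝 a, M + (z - a) • (1 : Matrix (Fin 2) (Fin 2) ℂ) ∈ U :=
      hcont.continuousAt.eventually (by simpa using hU.mem_nhds hMU)
    rw [frontier_eq_closure_inter_closure] at ha
    obtain ⟨z, hz, hzU⟩ := ((mem_closure_iff_frequently.1 ha.2).and_eventually hmem).exists
    exact ⟨z - a, hzU, by simpa using hz⟩
  obtain ⟨φ, hφ, ⟨g, hg⟩ | hdiv⟩ := hN id
  · have hlim := (hg {M + t • 1} (by simpa using htU) isCompact_singleton).tendsto_at rfl
    have hescape := ((tendsto_add_atTop_nat 1).comp hφ.tendsto_atTop).eventually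
      (eventually_forall_iterate_matrixPoly_notMem hp (isCompact_singleton (x := a + t))
        (by simpa using htK) (isCompact_closedBall (g (M + t • 1)) 1))
    obtain ⟨k, hk, hk'⟩ :=
      ((hlim.eventually (Metric.closedBall_mem_nhds _ one_pos)).and hescape).exists
    exact hk' _ _ _ (h.add_smul_one t) rfl hk
  · obtain ⟨k, hk⟩ := (hdiv {M} (by simpa using hMU) isCompact_singleton _
      (Bornology.IsBounded.isCompact_closure hM)).exists
    exact hk M rfl (subset_closure ⟨φ k + 1, rfl⟩)

theorem IsEigenPair.mem_juliaSet_of_mem_frontier (hp : 2 ≤ p.natDegree) (h : IsEigenPair M a b)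
    (ha : a ∈ frontier (filledJuliaSet (p.eval ·))) (hb : b ∈ filledJuliaSet (p.eval ·)) :
    M ∈ juliaSet (matrixPoly p) := by
  have haK := (isClosed_filledJuliaSet_eval hp).frontier_subset ha
  have hdistinct : ∀ {N c}, IsEigenPair N a c → a ≠ c → c ∈ filledJuliaSet (p.eval ·) →
      N ∈ juliaSet (matrixPoly p) := fun hN hac hc =>
    hN.mem_juliaSet_of_mem_filledJuliaSet hp ha (hN.mem_filledJuliaSet hp hac haK hc)
  rcases ne_or_eq a b with hab | rfl
  · exact hdistinct h hab hb
  -- `M` is a limit of matrices with eigenvalues `a ≠ w`, because `a` is not isolated.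
  obtain ⟨D, hD⟩ := h.exists_perturbation
  have hlim : Tendsto (fun w : ℂ => M + (w - a) • D) (𝓝 a) (𝓝 M) :=
    Continuous.tendsto' (by fun_prop) _ _ (by simp)
  refine (isClosed_juliaSet (matrixPoly p)).mem_of_frequently_of_tendsto ?_ hlim
  refine (accPt_iff_frequently.1 (preperfect_filledJuliaSet_eval hp a haK)).mono fun w hw => ?_
  exact hdistinct (hD (w - a)) (by simpa using hw.1.symm) (by simpa using hw.2)

theorem IsEigenPair.mem_juliaSet_iff (hp : 2 ≤ p.natDegree) (h : IsEigenPair M a b) :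
    M ∈ juliaSet (matrixPoly p) ↔
      a ∈ filledJuliaSet (p.eval ·) ∧ b ∈ filledJuliaSet (p.eval ·) ∧
        (a ∈ frontier (filledJuliaSet (p.eval ·)) ∨ b ∈ frontier (filledJuliaSet (p.eval ·))) := by
  constructor
  · intro hM
    have ha : a ∈ filledJuliaSet (p.eval ·) :=
      by_contra fun ha => hM (h.mem_fatouSet_of_notMem hp ha)
    have hb : b ∈ filledJuliaSet (p.eval ·) :=
      by_contra fun hb => hM (h.symm.mem_fatouSet_of_notMem hp hb)
    refine ⟨ha, hb, ?_⟩
    by_contra! hcon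
    have hint : ∀ c ∈ filledJuliaSet (p.eval ·), c ∉ frontier (filledJuliaSet (p.eval ·)) →
        c ∈ interior (filledJuliaSet (p.eval ·)) := fun c hc hc' =>
      by_contra fun hi => hc' ⟨subset_closure hc, hi⟩
    exact hM (h.mem_fatouSet_of_mem_interior hp (hint a ha hcon.1) (hint b hb hcon.2))
  · rintro ⟨ha, hb, hf | hf⟩
    · exact h.mem_juliaSet_of_mem_frontier hp hf hb
    · exact h.symm.mem_juliaSet_of_mem_frontier hp hf ha

theorem smul_one_mem_juliaSet_iff (hp : 2 ≤ p.natDegree) (c : ℂ) :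
    c • 1 ∈ juliaSet (matrixPoly p) ↔ c ∈ frontier (filledJuliaSet (p.eval ·)) := by
  rw [(IsEigenPair.smul_one c).mem_juliaSet_iff hp]
  have hsub : c ∈ frontier (filledJuliaSet (p.eval ·)) → c ∈ filledJuliaSet (p.eval ·) :=
    fun hc => (isClosed_filledJuliaSet_eval hp).frontier_subset hc
  tauto

theorem juliaSet_matrixPoly_eq_iff {q : ℂ[X]} (hp : 2 ≤ p.natDegree) (hq : 2 ≤ q.natDegree) :
    juliaSet (matrixPoly p) = juliaSet (matrixPoly q) ↔
      filledJuliaSet (p.eval ·) = filledJuliaSet (q.eval ·) := by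
  constructor <;> intro h
  · have hfrontier :
        frontier (filledJuliaSet (p.eval ·)) = frontier (filledJuliaSet (q.eval ·)) := by
      ext c
      rw [← smul_one_mem_juliaSet_iff hp, h, smul_one_mem_juliaSet_iff hq]
    exact (subset_filledJuliaSet_eval_of_frontier_subset hq (isBounded_filledJuliaSet_eval hp)
      (hfrontier ▸ (isClosed_filledJuliaSet_eval hq).frontier_subset)).antisymm
      (subset_filledJuliaSet_eval_of_frontier_subset hp (isBounded_filledJuliaSet_eval hq)
      (hfrontier ▸ (isClosed_filledJuliaSet_eval hp).frontier_subset))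
  · ext M
    obtain ⟨a, b, hab⟩ := exists_isEigenPair M
    rw [hab.mem_juliaSet_iff hp, hab.mem_juliaSet_iff hq, h]

end MatrixPoly

theorem mainTheorem7 (p q : ℂ[X]) (hp : 2 ≤ p.natDegree) (hq : 2 ≤ q.natDegree) :
    (matrixPoly p ∘ matrixPoly q = matrixPoly q ∘ matrixPoly p →
      juliaSet (matrixPoly p) = juliaSet (matrixPoly q)) ∧
    (juliaSet (matrixPoly p) = juliaSet (matrixPoly q) →
      ∃ (a b : ℂ) (S : Matrix (Fin 2) (Fin 2) ℂ → Matrix (Fin 2) (Fin 2) ℂ),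
        ‖a‖ = 1 ∧ (∀ M, S M = a • M + b • (1 : Matrix (Fin 2) (Fin 2) ℂ)) ∧
        matrixPoly p ∘ matrixPoly q = S ∘ matrixPoly q ∘ matrixPoly p) := by
  rw [juliaSet_matrixPoly_eq_iff hp hq]
  constructor
  · intro h
    have hcomm := commute_eval_of_commute_matrixPoly (congrFun h)
    exact (filledJuliaSet_subset_of_commute q.continuous hcomm
      (isBounded_filledJuliaSet_eval hp)).antisymm
      (filledJuliaSet_subset_of_commute p.continuous hcomm.symm (isBounded_filledJuliaSet_eval hq))
  · intro h
    obtain ⟨a, b, ha, hab⟩ := exists_comp_eq_C_mul_comp_add_C hp hq h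
    refine ⟨a, b, fun M => a • M + b • 1, ha, fun _ => rfl, funext fun M => ?_⟩
    simpa [matrixPoly_eq_aeval, aeval_comp, Algebra.algebraMap_eq_smul_one]
      using congrArg (aeval M) hab
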